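/- For each $n\in\mathbb N$ consider the fully observed model $Y=M+E$, $M=M_1+M_2+M_3+M_4$, of $N\times T$ real random matrices, with $$M_1=G_1(X)Q_1(Z)^\top,\quad M_2=G_2(X)V_1^\top,\quad M_3=W_1Q_2(Z)^\top,\quad M_4=W_2V_2^\top .$$ Here $x_i\in\mathbb R^{d_1}$ $(i\le N)$ and $z_t\in\mathbb R^{d_2}$ $(t\le T)$ are observed random characteristics of fixed dimensions $d_1,d_2\ge1$; $G_1(X)=(g_{1,k}(x_i))_{i,k\le K_1}$, $G_2(X)=(g_{2,k}(x_i))_{i,k\le K_2}$, $Q_1(Z)=(q_{1,k}(z_t))_{t,k\le K_1}$, $Q_2(Z)=(q_{2,k}(z_t))_{t,k\le K_3}$ for unknown measurable functions; and $W_1=(w_{1,ik})\in\mathbb R^{N\times K_3}$, $W_2=(w_{2,ik})\in\mathbb R^{N\times K_4}$, $V_1=(v_{1,tk})\in\mathbb R^{T\times K_2}$, $V_2=(v_{2,tk})\in\mathbb R^{T\times K_4}$ are unobserved random matrices. The sizes $N,T$, the sieve dimension $J\ge1$, the numbers $K_1,\dots,K_4\ge 0$, the probability space and all objects above may depend on $n$,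 and $N,T\to\infty$ as $n\to\infty$. No independence is assumed beyond assumption 1 below. Let $\phi_1,\dots,\phi_J$ and $\psi_1,\dots,\psi_J$ be measurable basis functions on $\mathbb R$, let $\boldsymbol\phi(x)=(\phi_j(x_l))_{l\le d_1,\,j\le J}\in\mathbb R^{Jd_1}$ and $\boldsymbol\psi(z)=(\psi_j(z_l))_{l\le d_2,\,j\le J}\in\mathbb R^{Jd_2}$, let $\Phi$ and $\Psi$ be the matrices with rows $\boldsymbol\phi(x_i)^\top$ and $\boldsymbol\psi(z_t)^\top$, and put $P_X=\Phi(\Phi^\top\Phi)^{-1}\Phi^\top$, $P_Z=\Psi(\Psi^\top\Psi)^{-1}\Psi^\top$. (The inverse of a singular matrix may be taken to be $0$; by assumption 2 this matters only on events of vanishing probability.) The four-part estimator is $\widehat M=\widehat M_1+\widehat M_2+\widehat M_3+\widehat M_4$, where $\widehat M_1=P_XYP_Z$ and $$\widehat M_2=\arg\min_A\|P_XY(I-P_Z)-A\|_F^2+C_2\sqrt T\,\|A\|_*,\qquad \widehat M_3=\arg\min_A\|(I-P_X)YP_Z-A\|_F^2+C_3\sqrt N\,\|A\|_*,$$ $$\widehat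 M_4=\arg\min_A\|(I-P_X)Y(I-P_Z)-A\|_F^2+C_4\sqrt{N+T}\,\|A\|_*,$$ the minima being over $A\in\mathbb R^{N\times T}$; $\|\cdot\|_F$ is the Frobenius norm and $\|\cdot\|_*$ the nuclear norm. Assume: 1. (Noise) The entries $\epsilon_{it}$ of $E$ are independent with mean zero, $E$ is independent of $(X,Z)$, and for some $\sigma$ (possibly depending on $n$) with $\sigma^2\le C_{\mathrm{var}}$, $\mathbb E[\epsilon_{it}^2]\le\sigma^2$ and $\mathbb E[e^{s\epsilon_{it}}]\le e^{C_{\mathrm{sub}}s^2\sigma^2}$ for all $s\in\mathbb R$, where $C_{\mathrm{var}},C_{\mathrm{sub}}>0$ are constants. 2. (Basis) For some constants $c,C>0$, with probability approaching one all singular values of $N^{-1}\Phi^\top\Phi$ and of $T^{-1}\Psi^\top\Psi$ lie strictly between $c$ and $C$; and $\mathbb E[\phi_j(x_{il})^4]<\infty$, $\mathbb E[\psi_j(z_{tl})^4]<\infty$ for all $i,t,j,l$. 3. (Sieve approximation) There are constants $\gamma_1^G,\gamma_2^G,\gamma_1^Q,\gamma_2^Q\ge2$ such that, with coefficient vectors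 $b_{\iota,k}\in\mathbb R^{Jd_1}$ and $a_{\iota,k}\in\mathbb R^{Jd_2}$, uniformly in $k$, $$\sup_x|g_{\iota,k}(x)-b_{\iota,k}^\top\boldsymbol\phi(x)|=O(J^{-\gamma_\iota^G}),\qquad \sup_z|q_{\iota,k}(z)-a_{\iota,k}^\top\boldsymbol\psi(z)|=O(J^{-\gamma_\iota^Q})\qquad(\iota=1,2),$$ the suprema being over the supports of the $x_i$ and of the $z_t$; moreover $$\frac{\sqrt T\,K_1}{J^{\gamma_1^G}}\to0,\quad \frac{\sqrt N\,K_1}{J^{\gamma_1^Q}}\to0,\quad \frac{\max\{\sqrt N,\sqrt T\}K_2}{J^{\gamma_2^G}}\to0,\quad \frac{\max\{\sqrt N,\sqrt T\}K_3}{J^{\gamma_2^Q}}\to0 .$$ 4. (Moments) $\mathbb E[m_{it}^4]$ (where $M=(m_{it})$), $\mathbb E[g_{\iota,k}(x_i)^2]$, $\mathbb E[q_{\iota,k}(z_t)^2]$, $\mathbb E[w_{\iota,ik}^2]$ and $\mathbb E[v_{\iota,tk}^2]$ are bounded by a constant, uniformly in $\iota,i,t,k$ and $n$. Then, provided the tuning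 constants $C_2,C_3,C_4$ are at least some constant $C_0>0$ depending only on $C_{\mathrm{var}},C_{\mathrm{sub}},d_1,d_2$, $$\begin{aligned}\|\widehat M-M\|_F=O_p\Big(&J+\sqrt{K_2+K_4}\,\min\{\sqrt T,\ \|M_2\|_F+\|P_XM_4\|_F\}\\&+\sqrt{K_3+K_4}\,\min\{\sqrt N,\ \|M_3\|_F+\|M_4P_Z\|_F\}+\sqrt{K_4}\,\min\{\sqrt{N+T},\ \|M_4\|_F\}\\&+\sqrt{NT}\Big[\frac{K_1}{J^{\gamma_1^G}}+\frac{K_1}{J^{\gamma_1^Q}}+\frac{K_2}{J^{\gamma_2^G}}+\frac{K_3}{J^{\gamma_2^Q}}\Big]\Big).\end{aligned}$$ Here $a_n=O_p(r_n)$, for a possibly random rate $r_n$, means that for every $\delta>0$ there is $C>0$ such that $P(|a_n|>Cr_n)\le\delta$ for all large $n$. -/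

import Mathlib

open MeasureTheory ProbabilityTheory Filter Topology

noncomputable section

/-- The Frobenius norm of a real matrix. -/
def frobNorm {m n : ℕ} (A : Matrix (Fin m) (Fin n) ℝ) : ℝ :=
  √(∑ i, ∑ t, A i t ^ 2)

/-- The singular values of a real matrix, in decreasing order, with multiplicity, indexed from `0`
and extended by `0`. -/
def matSingularValue {ι κ : Type*} [Fintype ι] [Fintype κ] [DecidableEq ι] [DecidableEq κ]
    (A : Matrix ι κ ℝ) (k : ℕ) : ℝ :=
  (Matrix.toEuclideanLin A).singularValues k

/-- The nuclear norm of a real matrix: the sum of its singular values. -/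
def nuclearNorm {m n : ℕ} (A : Matrix (Fin m) (Fin n) ℝ) : ℝ :=
  ∑ k ∈ Finset.range n, matSingularValue A k

/-- The largest singular value of a square matrix. -/
def lambdaMax {ι : Type*} [Fintype ι] [DecidableEq ι] (A : Matrix ι ι ℝ) : ℝ :=
  matSingularValue A 0

/-- The smallest singular value of a (nonempty) square matrix. -/
def lambdaMin {ι : Type*} [Fintype ι] [DecidableEq ι] (A : Matrix ι ι ℝ) : ℝ :=
  matSingularValue A (Fintype.card ι - 1)

/-- `A` minimizes `‖B - A‖_F ^ 2 + ν * ‖A‖_*` over all real matrices `A` of the size of `B`. -/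
def IsNuclearMinimizer {m n : ℕ} (B : Matrix (Fin m) (Fin n) ℝ) (ν : ℝ)
    (A : Matrix (Fin m) (Fin n) ℝ) : Prop :=
  ∀ A' : Matrix (Fin m) (Fin n) ℝ,
    frobNorm (B - A) ^ 2 + ν * nuclearNorm A ≤ frobNorm (B - A') ^ 2 + ν * nuclearNorm A'

/-- The random objects of the fully observed model at one stage of the asymptotics: row
characteristics `x i` in `ℝ^d₁`, column characteristics `z t` in `ℝ^d₂`, sieve bases `φ`, `ψ` of
size `J`, component functions `g₁, g₂, q₁, q₂`, unobserved factors `w₁, w₂, v₁, v₂`, and the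
noise `ε`. -/
structure SideInfoModel (d₁ d₂ : ℕ) (Ω : Type*) [MeasurableSpace Ω] where
  N : ℕ
  T : ℕ
  J : ℕ
  K₁ : ℕ
  K₂ : ℕ
  K₃ : ℕ
  K₄ : ℕ
  φ : Fin J → ℝ → ℝ
  ψ : Fin J → ℝ → ℝ
  g₁ : Fin K₁ → (Fin d₁ → ℝ) → ℝ
  g₂ : Fin K₂ → (Fin d₁ → ℝ) → ℝ
  q₁ : Fin K₁ → (Fin d₂ → ℝ) → ℝ
  q₂ : Fin K₃ → (Fin d₂ → ℝ) → ℝ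
  x : Ω → Fin N → Fin d₁ → ℝ
  z : Ω → Fin T → Fin d₂ → ℝ
  w₁ : Ω → Fin N → Fin K₃ → ℝ
  w₂ : Ω → Fin N → Fin K₄ → ℝ
  v₁ : Ω → Fin T → Fin K₂ → ℝ
  v₂ : Ω → Fin T → Fin K₄ → ℝ
  ε : Ω → Fin N → Fin T → ℝ
  measurable_φ : ∀ j, Measurable (φ j)
  measurable_ψ : ∀ j, Measurable (ψ j)
  measurable_g₁ : ∀ k, Measurable (g₁ k)
  measurable_g₂ : ∀ k, Measurable (g₂ k)
  measurable_q₁ : ∀ k, Measurable (q₁ k)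
  measurable_q₂ : ∀ k, Measurable (q₂ k)
  measurable_x : Measurable x
  measurable_z : Measurable z
  measurable_w₁ : Measurable w₁
  measurable_w₂ : Measurable w₂
  measurable_v₁ : Measurable v₁
  measurable_v₂ : Measurable v₂
  measurable_ε : Measurable ε

/-- The sieve vector: the `J` basis functions applied to each of the `d` coordinates. -/
def sieveVec {d J : ℕ} (b : Fin J → ℝ → ℝ) (x : Fin d → ℝ) (p : Fin d × Fin J) : ℝ :=
  b p.2 (x p.1)

/-- The matrix `F (F^⊤ F)⁻¹ F^⊤`: the projection onto the column space of `F`, if `F^⊤ F` is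
invertible. -/
def projMatrix {m : ℕ} {ι : Type*} [Fintype ι] [DecidableEq ι] (F : Matrix (Fin m) ι ℝ) :
    Matrix (Fin m) (Fin m) ℝ :=
  F * (F.transpose * F)⁻¹ * F.transpose

namespace SideInfoModel

variable {d₁ d₂ : ℕ} {Ω : Type*} [MeasurableSpace Ω] (S : SideInfoModel d₁ d₂ Ω)

/-- The `N × (J d₁)` sieve design matrix of the rows. -/
def Phi (ω : Ω) : Matrix (Fin S.N) (Fin d₁ × Fin S.J) ℝ :=
  Matrix.of fun i p => sieveVec S.φ (S.x ω i) p

/-- The `T × (J d₂)` sieve design matrix of the columns. -/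
def Psi (ω : Ω) : Matrix (Fin S.T) (Fin d₂ × Fin S.J) ℝ :=
  Matrix.of fun t p => sieveVec S.ψ (S.z ω t) p

def PX (ω : Ω) : Matrix (Fin S.N) (Fin S.N) ℝ := projMatrix (S.Phi ω)

def PZ (ω : Ω) : Matrix (Fin S.T) (Fin S.T) ℝ := projMatrix (S.Psi ω)

/-- `M₁ = G₁(X) Q₁(Z)^⊤`. -/
def M₁ (ω : Ω) : Matrix (Fin S.N) (Fin S.T) ℝ :=
  Matrix.of fun i t => ∑ k, S.g₁ k (S.x ω i) * S.q₁ k (S.z ω t)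

/-- `M₂ = G₂(X) V₁^⊤`. -/
def M₂ (ω : Ω) : Matrix (Fin S.N) (Fin S.T) ℝ :=
  Matrix.of fun i t => ∑ k, S.g₂ k (S.x ω i) * S.v₁ ω t k

/-- `M₃ = W₁ Q₂(Z)^⊤`. -/
def M₃ (ω : Ω) : Matrix (Fin S.N) (Fin S.T) ℝ :=
  Matrix.of fun i t => ∑ k, S.w₁ ω i k * S.q₂ k (S.z ω t)

/-- `M₄ = W₂ V₂^⊤`. -/
def M₄ (ω : Ω) : Matrix (Fin S.N) (Fin S.T) ℝ :=
  Matrix.of fun i t => ∑ k, S.w₂ ω i k * S.v₂ ω t k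

def M (ω : Ω) : Matrix (Fin S.N) (Fin S.T) ℝ := S.M₁ ω + S.M₂ ω + S.M₃ ω + S.M₄ ω

def E (ω : Ω) : Matrix (Fin S.N) (Fin S.T) ℝ := Matrix.of fun i t => S.ε ω i t

/-- The observed outcome matrix. -/
def Y (ω : Ω) : Matrix (Fin S.N) (Fin S.T) ℝ := S.M ω + S.E ω

/-- `Mhat` is the four-part estimator with tuning constants `C₂, C₃, C₄` at the outcome `ω`. -/
def IsFourPartEstimate (C₂ C₃ C₄ : ℝ) (ω : Ω) (Mhat : Matrix (Fin S.N) (Fin S.T) ℝ) : Prop :=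
  ∃ A₂ A₃ A₄ : Matrix (Fin S.N) (Fin S.T) ℝ,
    IsNuclearMinimizer (S.PX ω * S.Y ω * (1 - S.PZ ω)) (C₂ * √(S.T : ℝ)) A₂ ∧
    IsNuclearMinimizer ((1 - S.PX ω) * S.Y ω * S.PZ ω) (C₃ * √(S.N : ℝ)) A₃ ∧
    IsNuclearMinimizer ((1 - S.PX ω) * S.Y ω * (1 - S.PZ ω)) (C₄ * √((S.N : ℝ) + S.T)) A₄ ∧
    Mhat = S.PX ω * S.Y ω * S.PZ ω + A₂ + A₃ + A₄

/-- The rate in the convergence theorem. It is random, through the sizes of the components. -/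
def rate (γG₁ γG₂ γQ₁ γQ₂ : ℝ) (ω : Ω) : ℝ :=
  (S.J : ℝ)
  + √((S.K₂ : ℝ) + S.K₄) * min √(S.T : ℝ) (frobNorm (S.M₂ ω) + frobNorm (S.PX ω * S.M₄ ω))
  + √((S.K₃ : ℝ) + S.K₄) * min √(S.N : ℝ) (frobNorm (S.M₃ ω) + frobNorm (S.M₄ ω * S.PZ ω))
  + √(S.K₄ : ℝ) * min √((S.N : ℝ) + S.T) (frobNorm (S.M₄ ω))
  + √((S.N : ℝ) * S.T) *
      ((S.K₁ : ℝ) / (S.J : ℝ) ^ γG₁ + (S.K₁ : ℝ) / (S.J : ℝ) ^ γQ₁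
        + (S.K₂ : ℝ) / (S.J : ℝ) ^ γG₂ + (S.K₃ : ℝ) / (S.J : ℝ) ^ γQ₂)

/-- The support of the row characteristic `x i`. -/
def suppX (μ : Measure Ω) (i : Fin S.N) : Set (Fin d₁ → ℝ) :=
  (μ.map fun ω => S.x ω i).support

/-- The support of the column characteristic `z t`. -/
def suppZ (μ : Measure Ω) (t : Fin S.T) : Set (Fin d₂ → ℝ) :=
  (μ.map fun ω => S.z ω t).support

/-- Noise condition at one stage, with variance bound `C₁` and sub-Gaussian constant `C₂`. -/
def NoiseCondition (μ : Measure Ω) (C₁ C₂ : ℝ) : Prop :=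
  iIndepFun (fun (p : Fin S.N × Fin S.T) ω => S.ε ω p.1 p.2) μ ∧
  IndepFun S.ε (fun ω => (S.x ω, S.z ω)) μ ∧
  (∀ i t, ∫ ω, S.ε ω i t ∂μ = 0) ∧
  ∃ σ : ℝ, σ ^ 2 ≤ C₁ ∧
    (∀ i t, ∫ ω, S.ε ω i t ^ 2 ∂μ ≤ σ ^ 2) ∧
    ∀ i t, ∀ s : ℝ, Integrable (fun ω => Real.exp (s * S.ε ω i t)) μ ∧
      ∫ ω, Real.exp (s * S.ε ω i t) ∂μ ≤ Real.exp (C₂ * s ^ 2 * σ ^ 2)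

/-- The event that both normalized sieve Gram matrices have all singular values strictly between
`c` and `C`. -/
def gramEvent (c C : ℝ) : Set Ω :=
  {ω | c < lambdaMin ((S.N : ℝ)⁻¹ • ((S.Phi ω).transpose * S.Phi ω)) ∧
    lambdaMax ((S.N : ℝ)⁻¹ • ((S.Phi ω).transpose * S.Phi ω)) < C ∧
    c < lambdaMin ((S.T : ℝ)⁻¹ • ((S.Psi ω).transpose * S.Psi ω)) ∧
    lambdaMax ((S.T : ℝ)⁻¹ • ((S.Psi ω).transpose * S.Psi ω)) < C}

/-- The basis functions have finite fourth moments. -/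
def BasisMoments (μ : Measure Ω) : Prop :=
  (∀ j i l, Integrable (fun ω => S.φ j (S.x ω i l) ^ 4) μ) ∧
  (∀ j t l, Integrable (fun ω => S.ψ j (S.z ω t l) ^ 4) μ)

/-- All component functions are approximated by the sieves, uniformly over the supports, with
errors at most `C J ^ (-γ)`. -/
def SieveApprox (μ : Measure Ω) (γG₁ γG₂ γQ₁ γQ₂ C : ℝ) : Prop :=
  (∀ k, ∃ b : Fin d₁ × Fin S.J → ℝ, ∀ i, ∀ u ∈ S.suppX μ i,
    |S.g₁ k u - ∑ p, b p * sieveVec S.φ u p| ≤ C * (S.J : ℝ) ^ (-γG₁)) ∧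
  (∀ k, ∃ b : Fin d₁ × Fin S.J → ℝ, ∀ i, ∀ u ∈ S.suppX μ i,
    |S.g₂ k u - ∑ p, b p * sieveVec S.φ u p| ≤ C * (S.J : ℝ) ^ (-γG₂)) ∧
  (∀ k, ∃ a : Fin d₂ × Fin S.J → ℝ, ∀ t, ∀ u ∈ S.suppZ μ t,
    |S.q₁ k u - ∑ p, a p * sieveVec S.ψ u p| ≤ C * (S.J : ℝ) ^ (-γQ₁)) ∧
  (∀ k, ∃ a : Fin d₂ × Fin S.J → ℝ, ∀ t, ∀ u ∈ S.suppZ μ t,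
    |S.q₂ k u - ∑ p, a p * sieveVec S.ψ u p| ≤ C * (S.J : ℝ) ^ (-γQ₂))

/-- Moment conditions at one stage, with common bound `C`. -/
def MomentCondition (μ : Measure Ω) (C : ℝ) : Prop :=
  (∀ i t, Integrable (fun ω => S.M ω i t ^ 4) μ ∧ ∫ ω, S.M ω i t ^ 4 ∂μ ≤ C) ∧
  (∀ i k, Integrable (fun ω => S.g₁ k (S.x ω i) ^ 2) μ ∧
    ∫ ω, S.g₁ k (S.x ω i) ^ 2 ∂μ ≤ C) ∧
  (∀ i k, Integrable (fun ω => S.g₂ k (S.x ω i) ^ 2) μ ∧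
    ∫ ω, S.g₂ k (S.x ω i) ^ 2 ∂μ ≤ C) ∧
  (∀ t k, Integrable (fun ω => S.q₁ k (S.z ω t) ^ 2) μ ∧
    ∫ ω, S.q₁ k (S.z ω t) ^ 2 ∂μ ≤ C) ∧
  (∀ t k, Integrable (fun ω => S.q₂ k (S.z ω t) ^ 2) μ ∧
    ∫ ω, S.q₂ k (S.z ω t) ^ 2 ∂μ ≤ C) ∧
  (∀ i k, Integrable (fun ω => S.w₁ ω i k ^ 2) μ ∧ ∫ ω, S.w₁ ω i k ^ 2 ∂μ ≤ C) ∧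
  (∀ i k, Integrable (fun ω => S.w₂ ω i k ^ 2) μ ∧ ∫ ω, S.w₂ ω i k ^ 2 ∂μ ≤ C) ∧
  (∀ t k, Integrable (fun ω => S.v₁ ω t k ^ 2) μ ∧ ∫ ω, S.v₁ ω t k ^ 2 ∂μ ≤ C) ∧
  (∀ t k, Integrable (fun ω => S.v₂ ω t k ^ 2) μ ∧ ∫ ω, S.v₂ ω t k ^ 2 ∂μ ≤ C)

end SideInfoModel

/-- The events `A n` hold with probability approaching one. -/
def WithProbApproachingOne {Ω : ℕ → Type*} [∀ n, MeasurableSpace (Ω n)]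
    (μ : ∀ n, Measure (Ω n)) (A : ∀ n, Set (Ω n)) : Prop :=
  Tendsto (fun n => μ n (A n)ᶜ) atTop (𝓝 0)

/-- `a n = O_p(r n)`, for a possibly random nonnegative rate `r n`. -/
def IsBigOInProb {Ω : ℕ → Type*} [∀ n, MeasurableSpace (Ω n)]
    (μ : ∀ n, Measure (Ω n)) (a r : ∀ n, Ω n → ℝ) : Prop :=
  ∀ δ : ℝ, 0 < δ → ∃ C : ℝ, 0 < C ∧
    ∀ᶠ n in atTop, μ n {ω | C * r n ω < |a n ω|} ≤ ENNReal.ofReal δ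

end

/-!
The estimator splits `Y` into four blocks by the sieve projections `P = P_X` and `Q = P_Z`, and so
does the error: `P Y Q - P M Q = P E Q`, and each nuclear-norm minimizer `A₂, A₃, A₄` is compared
with the corresponding block of `M`.

In a penalized block the data are `L + R`. The signal `L` comes from the components that the sieve
spaces do not annihilate (`P (M₂ + M₄) (1 - Q)` in the second block), so it has rank at most the
number of their factors. The remainder `R` is the compressed noise plus the components that one of
`1 - P`, `1 - Q` almost annihilates. If the penalty level is at least `2 ‖R‖` in operator norm, then
comparing the minimizer with the competitor `L` bounds the error by the level times the square root
of the rank, and comparing it with the competitor `0` bounds the error by `3 ‖L‖_F`; together they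
give the minima in the rate (`IsNuclearMinimizer.frobNorm_sub_le_min`,
`frobNorm_fourPart_sub_le`). Both comparisons use only that the nuclear and operator norms are in
trace duality (`trace_transpose_mul_le_nuclearNorm`, `exists_norm_le_one_trace_eq_nuclearNorm`).

Three probabilistic facts make the penalty levels large enough. The projections are functions of
`(X, Z)`, which is independent of the noise, so they may be frozen; a net argument with Chernoff's
bound then shows that the noise compressed to spaces of total dimension at most `k` has operator
norm `O(√k)` outside an event of probability `exp (-k)`
(`measure_norm_random_compressed_noise_gt_le`). On the Gram event `J ≤ min N T`, so this yields the
levels `√T`, `√N`, `√(N + T)`. For `P E Q` the dimension is of order `J`, and passing to the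
Frobenius norm costs another `√J`, whence the term `J` of the rate. Finally, the sieve remainders
have Frobenius norm `O_p(√(N T) K J ^ (-γ))` by Markov's inequality
(`SideInfoModel.frobNorm_remainders_le`), which is a term of the rate, and is `o_p` of the penalty
levels by the assumed limits.
-/

section

open scoped Matrix.Norms.L2Operator Matrix RealInnerProductSpace

section Matrices
variable {m n : ℕ}

/-! ### Frobenius and operator norms -/

lemma frobNorm_nonneg (A : Matrix (Fin m) (Fin n) ℝ) : 0 ≤ frobNorm A := Real.sqrt_nonneg _

lemma frobNorm_sq (A : Matrix (Fin m) (Fin n) ℝ) : frobNorm A ^ 2 = ∑ i, ∑ t, A i t ^ 2 :=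
  Real.sq_sqrt (Finset.sum_nonneg fun _ _ => Finset.sum_nonneg fun _ _ => sq_nonneg _)

lemma frobNorm_eq_norm (A : Matrix (Fin m) (Fin n) ℝ) :
    frobNorm A = ‖WithLp.toLp 2 (fun p : Fin m × Fin n => A p.1 p.2)‖ := by
  rw [EuclideanSpace.norm_eq, frobNorm, Fintype.sum_prod_type]
  simp

lemma frobNorm_add_le (A B : Matrix (Fin m) (Fin n) ℝ) :
    frobNorm (A + B) ≤ frobNorm A + frobNorm B := by
  simp only [frobNorm_eq_norm]
  have h : (WithLp.toLp 2 (fun p : Fin m × Fin n => (A + B) p.1 p.2) :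
      EuclideanSpace ℝ (Fin m × Fin n)) = WithLp.toLp 2 (fun p : Fin m × Fin n => A p.1 p.2)
        + WithLp.toLp 2 (fun p : Fin m × Fin n => B p.1 p.2) := by
    ext p; simp
  rw [h]
  exact norm_add_le _ _

lemma frobNorm_neg (A : Matrix (Fin m) (Fin n) ℝ) : frobNorm (-A) = frobNorm A := by
  simp [frobNorm]

lemma frobNorm_sub_le (A B : Matrix (Fin m) (Fin n) ℝ) :
    frobNorm (A - B) ≤ frobNorm A + frobNorm B := by
  rw [sub_eq_add_neg, ← frobNorm_neg B]
  exact frobNorm_add_le _ _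

lemma frobNorm_transpose (A : Matrix (Fin m) (Fin n) ℝ) : frobNorm Aᵀ = frobNorm A := by
  rw [frobNorm, frobNorm, Finset.sum_comm]; rfl

lemma trace_transpose_mul (A B : Matrix (Fin m) (Fin n) ℝ) :
    (Aᵀ * B).trace = ∑ i, ∑ t, A i t * B i t := by
  rw [Finset.sum_comm]
  simp [Matrix.trace, Matrix.mul_apply]

lemma frobNorm_sq_eq_trace (A : Matrix (Fin m) (Fin n) ℝ) : frobNorm A ^ 2 = (Aᵀ * A).trace := by
  rw [frobNorm_sq, trace_transpose_mul]; simp [sq]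

lemma trace_transpose_mul_comm (A B : Matrix (Fin m) (Fin n) ℝ) :
    (Aᵀ * B).trace = (Bᵀ * A).trace := by
  simp only [trace_transpose_mul, mul_comm]

lemma trace_transpose_mul_le_frobNorm (A B : Matrix (Fin m) (Fin n) ℝ) :
    (Aᵀ * B).trace ≤ frobNorm A * frobNorm B := by
  have h := real_inner_le_norm (WithLp.toLp 2 (fun p : Fin m × Fin n => B p.1 p.2))
    (WithLp.toLp 2 (fun p : Fin m × Fin n => A p.1 p.2))
  rw [← frobNorm_eq_norm, ← frobNorm_eq_norm, EuclideanSpace.inner_eq_star_dotProduct,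
    dotProduct, Fintype.sum_prod_type] at h
  simp only [Pi.star_apply, star_trivial] at h
  rw [trace_transpose_mul, mul_comm]
  exact h

lemma norm_toEuclideanLin_le (A : Matrix (Fin m) (Fin n) ℝ) (x : EuclideanSpace ℝ (Fin n)) :
    ‖A.toEuclideanLin x‖ ≤ ‖A‖ * ‖x‖ :=
  Matrix.l2_opNorm_mulVec A x

lemma l2_opNorm_le (A : Matrix (Fin m) (Fin n) ℝ) {c : ℝ} (hc : 0 ≤ c)
    (h : ∀ x, ‖A.toEuclideanLin x‖ ≤ c * ‖x‖) : ‖A‖ ≤ c := by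
  rw [Matrix.l2_opNorm_def]
  exact ContinuousLinearMap.opNorm_le_bound _ hc h

lemma toEuclideanLin_mul {ι : Type*} [Fintype ι] [DecidableEq ι] (A : Matrix (Fin m) (Fin n) ℝ)
    (B : Matrix (Fin n) ι ℝ) (x : EuclideanSpace ℝ ι) :
    (A * B).toEuclideanLin x = A.toEuclideanLin (B.toEuclideanLin x) := by
  simp [Matrix.toLpLin_apply, Matrix.mulVec_mulVec]

lemma inner_toEuclideanLin_transpose (A : Matrix (Fin m) (Fin n) ℝ) (x : EuclideanSpace ℝ (Fin m))
    (y : EuclideanSpace ℝ (Fin n)) :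
    ⟪Aᵀ.toEuclideanLin x, y⟫ = ⟪x, A.toEuclideanLin y⟫ := by
  have := Matrix.toEuclideanLin_conjTranspose_eq_adjoint A
  rw [Matrix.conjTranspose_eq_transpose_of_trivial] at this
  rw [this, LinearMap.adjoint_inner_left]

lemma l2_opNorm_transpose (A : Matrix (Fin m) (Fin n) ℝ) : ‖Aᵀ‖ = ‖A‖ := by
  rw [← Matrix.conjTranspose_eq_transpose_of_trivial, Matrix.l2_opNorm_conjTranspose]

lemma frobNorm_sq_eq_sum_col (A : Matrix (Fin m) (Fin n) ℝ) :
    frobNorm A ^ 2 = ∑ t, ‖(WithLp.toLp 2 fun i => A i t : EuclideanSpace ℝ (Fin m))‖ ^ 2 := by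
  rw [frobNorm_sq, Finset.sum_comm]
  simp [EuclideanSpace.norm_sq_eq]

lemma frobNorm_mul_le {l : ℕ} (A : Matrix (Fin m) (Fin n) ℝ) (B : Matrix (Fin n) (Fin l) ℝ) :
    frobNorm (A * B) ≤ ‖A‖ * frobNorm B := by
  refine le_of_sq_le_sq ?_ (mul_nonneg (norm_nonneg _) (frobNorm_nonneg _))
  rw [mul_pow, frobNorm_sq_eq_sum_col, frobNorm_sq_eq_sum_col, Finset.mul_sum]
  refine Finset.sum_le_sum fun t _ => ?_
  rw [← mul_pow]
  refine pow_le_pow_left₀ (norm_nonneg _) ?_ 2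
  have h : (WithLp.toLp 2 fun i => (A * B) i t : EuclideanSpace ℝ (Fin m))
      = A.toEuclideanLin (WithLp.toLp 2 fun i => B i t) := by
    ext i; simp [Matrix.toLpLin_apply, Matrix.mul_apply, Matrix.mulVec, dotProduct]
  rw [h]
  exact norm_toEuclideanLin_le A _

lemma frobNorm_mul_le' {l : ℕ} (A : Matrix (Fin m) (Fin n) ℝ) (B : Matrix (Fin n) (Fin l) ℝ) :
    frobNorm (A * B) ≤ frobNorm A * ‖B‖ := by
  rw [← frobNorm_transpose, Matrix.transpose_mul, mul_comm, ← frobNorm_transpose A,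
    ← l2_opNorm_transpose B]
  exact frobNorm_mul_le _ _

lemma l2_opNorm_le_frobNorm (A : Matrix (Fin m) (Fin n) ℝ) : ‖A‖ ≤ frobNorm A := by
  refine l2_opNorm_le A (frobNorm_nonneg _) fun x => ?_
  refine le_of_sq_le_sq ?_ (mul_nonneg (frobNorm_nonneg _) (norm_nonneg _))
  rw [mul_pow, frobNorm_sq, EuclideanSpace.norm_sq_eq, EuclideanSpace.norm_sq_eq, Finset.sum_mul]
  refine Finset.sum_le_sum fun i _ => ?_
  simp only [Real.norm_eq_abs, sq_abs]
  rw [Matrix.ofLp_toLpLin, Matrix.toLin'_apply, Matrix.mulVec, dotProduct]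
  exact Finset.sum_mul_sq_le_sq_mul_sq _ _ _

/-! ### Trace duality of the nuclear norm and the operator norm -/

lemma trace_transpose_mul_eq_sum_inner {ι : Type*} [Fintype ι]
    (v : OrthonormalBasis ι ℝ (EuclideanSpace ℝ (Fin n))) (A B : Matrix (Fin m) (Fin n) ℝ) :
    (Aᵀ * B).trace = ∑ k, ⟪A.toEuclideanLin (v k), B.toEuclideanLin (v k)⟫ := by
  have h1 := LinearMap.trace_eq_sum_inner (Aᵀ * B).toEuclideanLin v
  have h2 := LinearMap.trace_eq_sum_inner (Aᵀ * B).toEuclideanLin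
    (EuclideanSpace.basisFun (Fin n) ℝ)
  rw [h1] at h2
  have h3 : (Aᵀ * B).trace = ∑ k, ⟪(EuclideanSpace.basisFun (Fin n) ℝ) k,
      (Aᵀ * B).toEuclideanLin ((EuclideanSpace.basisFun (Fin n) ℝ) k)⟫ := by
    simp only [Matrix.trace, Matrix.diag_apply, EuclideanSpace.basisFun_apply,
      EuclideanSpace.inner_single_left, map_one, one_mul]
    refine Finset.sum_congr rfl fun k _ => ?_
    simp [Matrix.toLpLin_apply, Matrix.mul_apply, Matrix.mulVec, dotProduct]
  rw [h3, ← h2]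
  refine Finset.sum_congr rfl fun k _ => ?_
  rw [toEuclideanLin_mul, real_inner_comm, inner_toEuclideanLin_transpose, real_inner_comm]

/-- A right singular basis: orthonormal vectors whose images are orthogonal, with the singular
values as their norms. -/
lemma exists_singular_basis (A : Matrix (Fin m) (Fin n) ℝ) :
    ∃ v : OrthonormalBasis (Fin n) ℝ (EuclideanSpace ℝ (Fin n)),
      (∀ i j, i ≠ j → ⟪A.toEuclideanLin (v i), A.toEuclideanLin (v j)⟫ = 0) ∧
      (∀ i : Fin n, ‖A.toEuclideanLin (v i)‖ = matSingularValue A i) := by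
  set T := A.toEuclideanLin
  have hn : Module.finrank ℝ (EuclideanSpace ℝ (Fin n)) = n := by simp
  have hT := T.isSymmetric_adjoint_comp_self
  have key : ∀ i j, ⟪T (hT.eigenvectorBasis hn i), T (hT.eigenvectorBasis hn j)⟫
      = hT.eigenvalues hn j * ⟪hT.eigenvectorBasis hn i, hT.eigenvectorBasis hn j⟫ := by
    intro i j
    rw [← LinearMap.adjoint_inner_right, ← LinearMap.comp_apply, hT.apply_eigenvectorBasis,
      inner_smul_right]
    rfl
  refine ⟨hT.eigenvectorBasis hn, fun i j hij => ?_, fun i => ?_⟩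
  · rw [key, (hT.eigenvectorBasis hn).inner_eq_zero hij, mul_zero]
  · have h := key i i
    rw [(hT.eigenvectorBasis hn).inner_eq_one, mul_one, real_inner_self_eq_norm_sq] at h
    rw [matSingularValue, LinearMap.singularValues_fin _ hn, ← h, Real.sqrt_sq (norm_nonneg _)]

lemma nuclearNorm_eq_sum_fin (A : Matrix (Fin m) (Fin n) ℝ) :
    nuclearNorm A = ∑ i : Fin n, matSingularValue A i := by
  rw [nuclearNorm, Finset.sum_range]

lemma nuclearNorm_nonneg (A : Matrix (Fin m) (Fin n) ℝ) : 0 ≤ nuclearNorm A :=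
  Finset.sum_nonneg fun _ _ => LinearMap.singularValues_nonneg _ _

lemma nuclearNorm_zero : nuclearNorm (0 : Matrix (Fin m) (Fin n) ℝ) = 0 := by
  simp [nuclearNorm, matSingularValue]

/-- Hölder's inequality for the operator and nuclear norms. -/
lemma trace_transpose_mul_le_nuclearNorm (W A : Matrix (Fin m) (Fin n) ℝ) :
    (Wᵀ * A).trace ≤ ‖W‖ * nuclearNorm A := by
  obtain ⟨v, -, hv⟩ := exists_singular_basis A
  rw [trace_transpose_mul_eq_sum_inner v, nuclearNorm_eq_sum_fin, Finset.mul_sum]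
  refine Finset.sum_le_sum fun k _ => (real_inner_le_norm _ _).trans ?_
  rw [hv]
  refine mul_le_mul_of_nonneg_right ?_ (LinearMap.singularValues_nonneg _ _)
  simpa using norm_toEuclideanLin_le W (v k)

/-- The nuclear norm is attained in the trace pairing at a contraction, the partial isometry of the
polar decomposition. -/
lemma exists_norm_le_one_trace_eq_nuclearNorm (A : Matrix (Fin m) (Fin n) ℝ) :
    ∃ W : Matrix (Fin m) (Fin n) ℝ, ‖W‖ ≤ 1 ∧ (Wᵀ * A).trace = nuclearNorm A := by
  obtain ⟨v, hv0, hv⟩ := exists_singular_basis A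
  set u : Fin n → EuclideanSpace ℝ (Fin m) :=
    fun k => (‖A.toEuclideanLin (v k)‖)⁻¹ • A.toEuclideanLin (v k) with hu
  set W : Matrix (Fin m) (Fin n) ℝ := Matrix.toEuclideanLin.symm (v.toBasis.constr ℝ u) with hW
  have hWl : W.toEuclideanLin = v.toBasis.constr ℝ u := by simp [hW]
  have hWv : ∀ k, W.toEuclideanLin (v k) = u k := by
    intro k
    have := v.toBasis.constr_basis ℝ u k
    rw [v.coe_toBasis] at this
    rw [hWl, this]
  have hun : ∀ k, ‖u k‖ ^ 2 ≤ 1 := by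
    intro k
    simp only [hu, norm_smul, norm_inv, norm_norm]
    by_cases h : ‖A.toEuclideanLin (v k)‖ = 0
    · simp [h]
    · rw [inv_mul_cancel₀ h]; norm_num
  have hu0 : ∀ i j, i ≠ j → ⟪u i, u j⟫ = 0 := by
    intro i j hij
    simp [hu, inner_smul_left, inner_smul_right, hv0 i j hij]
  refine ⟨W, ?_, ?_⟩
  · refine l2_opNorm_le W zero_le_one fun x => ?_
    rw [one_mul]
    refine le_of_sq_le_sq ?_ (norm_nonneg _)
    have hx : W.toEuclideanLin x = ∑ k, ⟪v k, x⟫ • u k := by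
      conv_lhs => rw [← v.sum_repr' x]
      simp only [map_sum, map_smul, hWv]
    have h1 : ‖W.toEuclideanLin x‖ ^ 2 = ∑ k, ⟪v k, x⟫ ^ 2 * ‖u k‖ ^ 2 := by
      rw [hx, ← real_inner_self_eq_norm_sq, sum_inner]
      refine Finset.sum_congr rfl fun k _ => ?_
      rw [inner_sum, Finset.sum_eq_single k]
      · rw [inner_smul_left, inner_smul_right, real_inner_self_eq_norm_sq]
        simp only [conj_trivial]; ring
      · intro j _ hj
        rw [inner_smul_left, inner_smul_right, hu0 k j hj.symm]; simp
      · simp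
    rw [h1, ← v.sum_sq_norm_inner_right x]
    refine Finset.sum_le_sum fun k _ => ?_
    rw [Real.norm_eq_abs, sq_abs]
    exact mul_le_of_le_one_right (sq_nonneg _) (hun k)
  · rw [trace_transpose_mul_eq_sum_inner v, nuclearNorm_eq_sum_fin]
    refine Finset.sum_congr rfl fun k _ => ?_
    rw [hWv, hu, inner_smul_left, real_inner_self_eq_norm_sq, ← hv]
    simp only [conj_trivial]
    by_cases h : ‖A.toEuclideanLin (v k)‖ = 0
    · simp [h]
    · field_simp

/-! ### Orthogonal projections -/

/-- A matrix is an orthogonal projection: symmetric and idempotent. -/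
structure IsOrthProj {m : ℕ} (P : Matrix (Fin m) (Fin m) ℝ) : Prop where
  symm : Pᵀ = P
  idem : P * P = P

namespace IsOrthProj

variable {P : Matrix (Fin m) (Fin m) ℝ} {Q : Matrix (Fin n) (Fin n) ℝ}

lemma compl (hP : IsOrthProj P) : IsOrthProj (1 - P) where
  symm := by simp [hP.symm]
  idem := by simp [mul_sub, sub_mul, hP.idem]

lemma one : IsOrthProj (1 : Matrix (Fin m) (Fin m) ℝ) := ⟨by simp, by simp⟩

lemma norm_le_one (hP : IsOrthProj P) : ‖P‖ ≤ 1 := by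
  have h := Matrix.l2_opNorm_conjTranspose_mul_self P
  rw [Matrix.conjTranspose_eq_transpose_of_trivial, hP.symm, hP.idem] at h
  by_contra! hc
  nlinarith

lemma trace_nonneg (hP : IsOrthProj P) : 0 ≤ P.trace := by
  rw [← hP.idem]
  nth_rw 1 [← hP.symm]
  rw [← frobNorm_sq_eq_trace]
  positivity

lemma frobNorm_mul_left_le (hP : IsOrthProj P) (A : Matrix (Fin m) (Fin n) ℝ) :
    frobNorm (P * A) ≤ frobNorm A :=
  (frobNorm_mul_le _ _).trans (mul_le_of_le_one_left (frobNorm_nonneg _) hP.norm_le_one)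

lemma frobNorm_mul_right_le (hQ : IsOrthProj Q) (A : Matrix (Fin m) (Fin n) ℝ) :
    frobNorm (A * Q) ≤ frobNorm A :=
  (frobNorm_mul_le' _ _).trans (mul_le_of_le_one_right (frobNorm_nonneg _) hQ.norm_le_one)

lemma norm_mul_left_le (hP : IsOrthProj P) (A : Matrix (Fin m) (Fin n) ℝ) :
    ‖P * A‖ ≤ ‖A‖ :=
  (Matrix.l2_opNorm_mul _ _).trans (mul_le_of_le_one_left (norm_nonneg _) hP.norm_le_one)

lemma norm_mul_right_le (hQ : IsOrthProj Q) (A : Matrix (Fin m) (Fin n) ℝ) :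
    ‖A * Q‖ ≤ ‖A‖ :=
  (Matrix.l2_opNorm_mul _ _).trans (mul_le_of_le_one_right (norm_nonneg _) hQ.norm_le_one)

lemma frobNorm_sq_eq_trace (hP : IsOrthProj P) : frobNorm P ^ 2 = P.trace := by
  rw [_root_.frobNorm_sq_eq_trace, hP.symm, hP.idem]

lemma frobNorm_eq_sqrt_trace (hP : IsOrthProj P) : frobNorm P = √P.trace := by
  rw [← hP.frobNorm_sq_eq_trace, Real.sqrt_sq (frobNorm_nonneg _)]

lemma frobNorm_mul_le_sqrt_trace (hP : IsOrthProj P) (A : Matrix (Fin m) (Fin n) ℝ) :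
    frobNorm (P * A) ≤ √P.trace * ‖A‖ := by
  rw [← hP.frobNorm_eq_sqrt_trace]
  exact frobNorm_mul_le' _ _

/-- Compression to a subspace of dimension `tr P` costs at most `√(tr P)` between the trace pairing
with a contraction and the Frobenius norm. -/
lemma trace_pairing_left_le (hP : IsOrthProj P) {W : Matrix (Fin m) (Fin n) ℝ} (hW : ‖W‖ ≤ 1)
    (A : Matrix (Fin m) (Fin n) ℝ) : (Wᵀ * (P * A)).trace ≤ √P.trace * frobNorm A := by
  have h : Wᵀ * (P * A) = (P * W)ᵀ * A := by
    rw [Matrix.transpose_mul, hP.symm, Matrix.mul_assoc]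
  rw [h]
  refine (trace_transpose_mul_le_frobNorm _ _).trans
    (mul_le_mul_of_nonneg_right ?_ (frobNorm_nonneg _))
  exact (hP.frobNorm_mul_le_sqrt_trace W).trans (mul_le_of_le_one_right (Real.sqrt_nonneg _) hW)

lemma trace_pairing_right_le (hQ : IsOrthProj Q) {W : Matrix (Fin m) (Fin n) ℝ} (hW : ‖W‖ ≤ 1)
    (A : Matrix (Fin m) (Fin n) ℝ) : (Wᵀ * (A * Q)).trace ≤ √Q.trace * frobNorm A := by
  have h := hQ.trace_pairing_left_le (W := Wᵀ) (by rwa [l2_opNorm_transpose]) Aᵀ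
  rw [frobNorm_transpose] at h
  convert h using 1
  rw [← Matrix.trace_transpose]
  simp only [Matrix.transpose_mul, Matrix.transpose_transpose, hQ.symm]
  rw [Matrix.trace_mul_comm]

/-- The dimension of the range of an orthogonal projection is its trace. -/
lemma finrank_range (hP : IsOrthProj P) :
    (Module.finrank ℝ (LinearMap.range P.toEuclideanLin) : ℝ) = P.trace := by
  have hproj : LinearMap.IsProj (LinearMap.range P.toEuclideanLin) P.toEuclideanLin := by
    refine ⟨fun x => LinearMap.mem_range_self _ x, ?_⟩
    rintro _ ⟨y, rfl⟩
    rw [← toEuclideanLin_mul, hP.idem]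
  rw [← hproj.trace, LinearMap.trace_eq_sum_inner _ (EuclideanSpace.basisFun (Fin m) ℝ)]
  have := trace_transpose_mul_eq_sum_inner (EuclideanSpace.basisFun (Fin m) ℝ) 1 P
  simpa using this.symm

end IsOrthProj

/-- The orthogonal projection onto the column space of a matrix has trace at most the number of
columns. -/
lemma exists_orthProj_mul_eq {ι : Type*} [Fintype ι] [DecidableEq ι] (G : Matrix (Fin m) ι ℝ) :
    ∃ P : Matrix (Fin m) (Fin m) ℝ, IsOrthProj P ∧ P * G = G ∧ P.trace ≤ Fintype.card ι := by
  set K := LinearMap.range G.toEuclideanLin with hK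
  set p := K.starProjection with hp
  set P : Matrix (Fin m) (Fin m) ℝ := Matrix.toEuclideanLin.symm (p : _ →ₗ[ℝ] _) with hPdef
  have hPl : ∀ x, P.toEuclideanLin x = p x := by intro x; simp [hPdef]
  have hPG : P * G = G := by
    refine Matrix.toEuclideanLin.injective (LinearMap.ext fun x => ?_)
    rw [toEuclideanLin_mul, hPl, Submodule.starProjection_eq_self_iff]
    exact LinearMap.mem_range_self _ x
  have hP : IsOrthProj P := by
    refine ⟨Matrix.toEuclideanLin.injective (LinearMap.ext fun x => ext_inner_right ℝ fun y => ?_),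
      Matrix.toEuclideanLin.injective (LinearMap.ext fun x => ?_)⟩
    · rw [inner_toEuclideanLin_transpose, hPl, hPl, hp,
        Submodule.inner_starProjection_left_eq_right]
    · rw [toEuclideanLin_mul, hPl, hPl, Submodule.starProjection_eq_self_iff]
      exact Submodule.starProjection_apply_mem _ _
  refine ⟨P, hP, hPG, ?_⟩
  rw [← hP.finrank_range]
  have h1 : LinearMap.range P.toEuclideanLin ≤ K := by
    rintro _ ⟨y, rfl⟩
    rw [hPl]; exact Submodule.starProjection_apply_mem _ _
  have h2 := Submodule.finrank_mono h1
  have h3 := LinearMap.finrank_range_le G.toEuclideanLin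
  rw [finrank_euclideanSpace] at h3
  exact_mod_cast h2.trans h3

end Matrices

section NuclearMinimizer
variable {m n : ℕ}

/-! ### Nuclear-norm penalized least squares -/

lemma frobNorm_sub_sq (A B : Matrix (Fin m) (Fin n) ℝ) :
    frobNorm (A - B) ^ 2 = frobNorm A ^ 2 - 2 * (Aᵀ * B).trace + frobNorm B ^ 2 := by
  simp only [frobNorm_sq_eq_trace, Matrix.transpose_sub, Matrix.sub_mul, Matrix.mul_sub,
    Matrix.trace_sub]
  rw [trace_transpose_mul_comm B A]
  ring

lemma IsOrthProj.norm_sq_add_norm_sq_compl {P : Matrix (Fin m) (Fin m) ℝ} (hP : IsOrthProj P)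
    (x : EuclideanSpace ℝ (Fin m)) :
    ‖P.toEuclideanLin x‖ ^ 2 + ‖(1 - P).toEuclideanLin x‖ ^ 2 = ‖x‖ ^ 2 := by
  have key : ∀ {R : Matrix (Fin m) (Fin m) ℝ}, IsOrthProj R →
      ‖R.toEuclideanLin x‖ ^ 2 = ⟪x, R.toEuclideanLin x⟫ := by
    intro R hR
    rw [← real_inner_self_eq_norm_sq, ← inner_toEuclideanLin_transpose, hR.symm,
      ← toEuclideanLin_mul, hR.idem, real_inner_comm]
  rw [key hP, key hP.compl, ← inner_add_right, ← LinearMap.add_apply, ← map_add,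
    add_sub_cancel, ← real_inner_self_eq_norm_sq]
  simp

/-- Gluing contractions on complementary row and column spaces gives a contraction. -/
lemma norm_pinch_le_one {P : Matrix (Fin m) (Fin m) ℝ} {Q : Matrix (Fin n) (Fin n) ℝ}
    (hP : IsOrthProj P) (hQ : IsOrthProj Q) {W₀ W₁ : Matrix (Fin m) (Fin n) ℝ}
    (h₀ : ‖W₀‖ ≤ 1) (h₁ : ‖W₁‖ ≤ 1) :
    ‖P * W₀ * Q + (1 - P) * W₁ * (1 - Q)‖ ≤ 1 := by
  set W := P * W₀ * Q + (1 - P) * W₁ * (1 - Q) with hW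
  have hPc : P * (1 - P) = 0 := by rw [mul_sub, mul_one, hP.idem, sub_self]
  have hcP : (1 - P) * P = 0 := by rw [sub_mul, one_mul, hP.idem, sub_self]
  have e₀ : P * W = (P * W₀) * Q := by
    rw [hW, Matrix.mul_add, ← Matrix.mul_assoc, ← Matrix.mul_assoc, hP.idem, ← Matrix.mul_assoc,
      ← Matrix.mul_assoc, hPc]
    simp
  have e₁ : (1 - P) * W = ((1 - P) * W₁) * (1 - Q) := by
    rw [hW, Matrix.mul_add, ← Matrix.mul_assoc, ← Matrix.mul_assoc, hcP, ← Matrix.mul_assoc,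
      ← Matrix.mul_assoc, hP.compl.idem]
    simp
  have contr : ∀ {B : Matrix (Fin m) (Fin n) ℝ}, ‖B‖ ≤ 1 → ∀ y, ‖B.toEuclideanLin y‖ ≤ ‖y‖ :=
    fun hB y => (norm_toEuclideanLin_le _ y).trans (mul_le_of_le_one_left (norm_nonneg _) hB)
  refine l2_opNorm_le W zero_le_one fun x => ?_
  rw [one_mul]
  refine le_of_sq_le_sq ?_ (norm_nonneg _)
  rw [← hP.norm_sq_add_norm_sq_compl, ← hQ.norm_sq_add_norm_sq_compl x, ← toEuclideanLin_mul,
    ← toEuclideanLin_mul, e₀, e₁, toEuclideanLin_mul, toEuclideanLin_mul _ (1 - Q)]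
  refine add_le_add (pow_le_pow_left₀ (norm_nonneg _) (contr ?_ _) 2)
    (pow_le_pow_left₀ (norm_nonneg _) (contr ?_ _) 2)
  · exact (hP.norm_mul_left_le _).trans h₀
  · exact (hP.compl.norm_mul_left_le _).trans h₁

/-- The nuclear norm is almost additive over a matrix `L` supported on the row and column spaces
given by `P`, `Q`, and the complementary block of a perturbation `D`: the defect is controlled by
the Frobenius norm of `D` and the dimensions of the spaces. -/
lemma nuclearNorm_add_compl_block_le {P : Matrix (Fin m) (Fin m) ℝ} {Q : Matrix (Fin n) (Fin n) ℝ}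
    (hP : IsOrthProj P) (hQ : IsOrthProj Q) {L : Matrix (Fin m) (Fin n) ℝ}
    (hPL : P * L = L) (hLQ : L * Q = L) (D : Matrix (Fin m) (Fin n) ℝ) :
    nuclearNorm L + nuclearNorm ((1 - P) * D * (1 - Q)) ≤
      nuclearNorm (L + D) + (√P.trace + √Q.trace) * frobNorm D := by
  obtain ⟨W₀, hW₀, e₀⟩ := exists_norm_le_one_trace_eq_nuclearNorm L
  obtain ⟨W₁, hW₁, e₁⟩ := exists_norm_le_one_trace_eq_nuclearNorm ((1 - P) * D * (1 - Q))
  set W := P * W₀ * Q + (1 - P) * W₁ * (1 - Q) with hW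
  have hWn : ‖W‖ ≤ 1 := norm_pinch_le_one hP hQ hW₀ hW₁
  have hPc : P * (1 - P) = 0 := by rw [mul_sub, mul_one, hP.idem, sub_self]
  have hcL : (1 - P) * L = 0 := by rw [Matrix.sub_mul, Matrix.one_mul, hPL, sub_self]
  have hWt : Wᵀ = Q * (W₀ᵀ * P) + (1 - Q) * (W₁ᵀ * (1 - P)) := by
    simp only [hW, Matrix.transpose_add, Matrix.transpose_mul, hP.symm, hQ.symm, hP.compl.symm,
      hQ.compl.symm]
  have t₀ : (Wᵀ * L).trace = nuclearNorm L := by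
    rw [hWt, Matrix.add_mul, Matrix.mul_assoc, Matrix.mul_assoc _ P, hPL, Matrix.mul_assoc,
      Matrix.mul_assoc _ (1 - P), hcL, ← e₀, Matrix.mul_zero, Matrix.mul_zero, add_zero,
      Matrix.trace_mul_comm, Matrix.mul_assoc, hLQ]
  have t₁ : (Wᵀ * ((1 - P) * D * (1 - Q))).trace = nuclearNorm ((1 - P) * D * (1 - Q)) := by
    have a : P * ((1 - P) * D * (1 - Q)) = 0 := by
      rw [← Matrix.mul_assoc, ← Matrix.mul_assoc, hPc]; simp
    have b : (1 - P) * ((1 - P) * D * (1 - Q)) = (1 - P) * D * (1 - Q) := by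
      rw [← Matrix.mul_assoc, ← Matrix.mul_assoc, hP.compl.idem]
    have c : ((1 - P) * D * (1 - Q)) * (1 - Q) = (1 - P) * D * (1 - Q) := by
      rw [Matrix.mul_assoc, hQ.compl.idem]
    rw [hWt, Matrix.add_mul, Matrix.mul_assoc, Matrix.mul_assoc _ P, a, Matrix.mul_assoc,
      Matrix.mul_assoc _ (1 - P), b, ← e₁, Matrix.mul_zero, Matrix.mul_zero, zero_add,
      Matrix.trace_mul_comm, Matrix.mul_assoc, c]
  have hsplit : L + D = L + (1 - P) * D * (1 - Q) - P * (-D) - ((1 - P) * (-D)) * Q := by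
    simp only [Matrix.sub_mul, Matrix.mul_sub, Matrix.one_mul, Matrix.mul_one, Matrix.mul_neg,
      Matrix.neg_mul]
    abel
  have up := trace_transpose_mul_le_nuclearNorm W (L + D)
  have up' : (Wᵀ * (L + D)).trace ≤ nuclearNorm (L + D) :=
    up.trans (mul_le_of_le_one_left (nuclearNorm_nonneg _) hWn)
  have b₁ := hP.trace_pairing_left_le hWn (-D)
  have b₂ := hQ.trace_pairing_right_le hWn ((1 - P) * (-D))
  have b₃ : frobNorm ((1 - P) * (-D)) ≤ frobNorm D := by
    rw [← frobNorm_neg D]; exact hP.compl.frobNorm_mul_left_le _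
  rw [frobNorm_neg] at b₁
  have b₄ := mul_le_mul_of_nonneg_left b₃ (Real.sqrt_nonneg Q.trace)
  rw [hsplit, Matrix.mul_sub, Matrix.mul_sub, Matrix.mul_add, Matrix.trace_sub, Matrix.trace_sub,
    Matrix.trace_add, t₀, t₁, ← hsplit] at up'
  linarith

/-- If the penalty dominates twice the operator norm of the noise, then the minimizer is no larger
than twice the signal in Frobenius norm: compare with the competitor `0`. -/
lemma IsNuclearMinimizer.frobNorm_le {L R A : Matrix (Fin m) (Fin n) ℝ} {ν : ℝ}
    (h : IsNuclearMinimizer (L + R) ν A) (hν : 2 * ‖R‖ ≤ ν) : frobNorm A ≤ 2 * frobNorm L := by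
  have h0 := h 0
  rw [sub_zero, nuclearNorm_zero, mul_zero, add_zero, frobNorm_sub_sq, Matrix.transpose_add,
    Matrix.add_mul, Matrix.trace_add] at h0
  have h1 := trace_transpose_mul_le_frobNorm L A
  have h2 := trace_transpose_mul_le_nuclearNorm R A
  have h3 := mul_le_mul_of_nonneg_right hν (nuclearNorm_nonneg A)
  have h4 : frobNorm A * frobNorm A ≤ (2 * frobNorm L) * frobNorm A := by nlinarith
  rcases (frobNorm_nonneg A).eq_or_lt with h5 | h5
  · rw [← h5]; exact mul_nonneg zero_le_two (frobNorm_nonneg L)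
  · exact le_of_mul_le_mul_right h4 h5

/-- If the penalty dominates twice the operator norm of the noise, then the error of the minimizer
is of the order of the penalty times the square root of the rank of the signal. -/
lemma IsNuclearMinimizer.frobNorm_sub_le {L R A : Matrix (Fin m) (Fin n) ℝ} {ν r : ℝ}
    (h : IsNuclearMinimizer (L + R) ν A) (hν : 2 * ‖R‖ ≤ ν)
    {P : Matrix (Fin m) (Fin m) ℝ} {Q : Matrix (Fin n) (Fin n) ℝ}
    (hP : IsOrthProj P) (hQ : IsOrthProj Q) (hPL : P * L = L) (hLQ : L * Q = L)
    (hPr : P.trace ≤ r) (hQr : Q.trace ≤ r) : frobNorm (A - L) ≤ 4 * ν * √r := by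
  set D := A - L with hD
  have hAD : A = L + D := by rw [hD]; abel
  have hν0 : 0 ≤ ν := (mul_nonneg zero_le_two (norm_nonneg _)).trans hν
  have h0 := h L
  have e1 : L + R - A = R - D := by rw [hD]; abel
  have e2 : L + R - L = R := by abel
  rw [e1, e2, frobNorm_sub_sq] at h0
  have hsub := nuclearNorm_add_compl_block_le hP hQ hPL hLQ D
  rw [← hAD] at hsub
  have hs : (√P.trace + √Q.trace) * frobNorm D ≤ (2 * √r) * frobNorm D := by
    refine mul_le_mul_of_nonneg_right ?_ (frobNorm_nonneg _)
    linarith [Real.sqrt_le_sqrt hPr, Real.sqrt_le_sqrt hQr]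
  -- the block of `D` meeting the row or column space of `L` is paired with `R` through rank
  have hN : (Rᵀ * D).trace ≤ ‖R‖ * ((2 * √r) * frobNorm D
      + nuclearNorm ((1 - P) * D * (1 - Q))) := by
    have hsplit : D = P * D + ((1 - P) * D) * Q + (1 - P) * D * (1 - Q) := by
      simp only [Matrix.sub_mul, Matrix.mul_sub, Matrix.one_mul, Matrix.mul_one]
      abel
    have c1 : (Rᵀ * (P * D)).trace ≤ ‖R‖ * (√P.trace * frobNorm D) := by
      have : Rᵀ * (P * D) = (P * R)ᵀ * D := by rw [Matrix.transpose_mul, hP.symm, Matrix.mul_assoc]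
      rw [this]
      refine (trace_transpose_mul_le_frobNorm _ _).trans ?_
      rw [← mul_assoc]
      refine mul_le_mul_of_nonneg_right ?_ (frobNorm_nonneg _)
      rw [mul_comm]; exact hP.frobNorm_mul_le_sqrt_trace R
    have c2 : (Rᵀ * (((1 - P) * D) * Q)).trace ≤ ‖R‖ * (√Q.trace * frobNorm D) := by
      have : (Rᵀ * (((1 - P) * D) * Q)).trace = ((R * Q)ᵀ * ((1 - P) * D)).trace := by
        rw [Matrix.transpose_mul, hQ.symm, ← Matrix.mul_assoc, Matrix.trace_mul_comm,
          ← Matrix.mul_assoc]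
      rw [this]
      refine (trace_transpose_mul_le_frobNorm _ _).trans ?_
      rw [← mul_assoc, ← hQ.frobNorm_eq_sqrt_trace]
      exact mul_le_mul (frobNorm_mul_le _ _) (hP.compl.frobNorm_mul_left_le _)
        (frobNorm_nonneg _) (mul_nonneg (norm_nonneg _) (frobNorm_nonneg _))
    have c3 := trace_transpose_mul_le_nuclearNorm R ((1 - P) * D * (1 - Q))
    have c4 := mul_le_mul_of_nonneg_left hs (norm_nonneg R)
    have c5 : (Rᵀ * D).trace = (Rᵀ * (P * D)).trace + (Rᵀ * (((1 - P) * D) * Q)).trace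
        + (Rᵀ * ((1 - P) * D * (1 - Q))).trace := by
      rw [← Matrix.trace_add, ← Matrix.trace_add, ← Matrix.mul_add, ← Matrix.mul_add, ← hsplit]
    rw [c5]
    linarith
  set b := nuclearNorm ((1 - P) * D * (1 - Q))
  set s := (2 * √r) * frobNorm D with hsdef
  have hb : 0 ≤ b := nuclearNorm_nonneg _
  have hs0 : 0 ≤ s := by have := frobNorm_nonneg D; positivity
  have g1 : 2 * ‖R‖ * (s + b) ≤ ν * (s + b) :=
    mul_le_mul_of_nonneg_right hν (by positivity)
  have g2 : ν * (nuclearNorm L + b) ≤ ν * (nuclearNorm A + s) :=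
    mul_le_mul_of_nonneg_left (by linarith) hν0
  have g3 : frobNorm D * frobNorm D ≤ (4 * ν * √r) * frobNorm D := by
    have : 2 * (ν * s) = (4 * ν * √r) * frobNorm D := by rw [hsdef]; ring
    nlinarith
  rcases (frobNorm_nonneg D).eq_or_lt with h5 | h5
  · rw [← h5]; positivity
  · exact le_of_mul_le_mul_right g3 h5

/-- Both regimes together, for a signal of rank at most `card ι` in factored form: the error is
controlled by the penalty level and by the size of the signal, whichever is smaller. -/
lemma IsNuclearMinimizer.frobNorm_sub_le_min {L R A : Matrix (Fin m) (Fin n) ℝ} {ν : ℝ}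
    (h : IsNuclearMinimizer (L + R) ν A) (hν : 2 * ‖R‖ ≤ ν)
    {ι : Type*} [Fintype ι] [DecidableEq ι] (G : Matrix (Fin m) ι ℝ) (H : Matrix ι (Fin n) ℝ)
    (hL : L = G * H) :
    frobNorm (A - L) ≤ 4 * (√(Fintype.card ι) * min ν (frobNorm L)) := by
  set r := Fintype.card ι with hr
  obtain ⟨P, hP, hPG, hPr⟩ := exists_orthProj_mul_eq G
  obtain ⟨Q, hQ, hQH, hQr⟩ := exists_orthProj_mul_eq Hᵀ
  have hHQ : H * Q = H := by
    rw [← Matrix.transpose_inj, Matrix.transpose_mul, hQ.symm, hQH]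
  have h1 := h.frobNorm_sub_le hν hP hQ (r := r) (by rw [hL, ← Matrix.mul_assoc, hPG])
    (by rw [hL, Matrix.mul_assoc, hHQ]) hPr hQr
  have h2 : frobNorm (A - L) ≤ 3 * frobNorm L := by
    linarith [_root_.frobNorm_sub_le A L, h.frobNorm_le hν]
  rcases Nat.eq_zero_or_pos r with h0 | hr
  · simpa [h0] using h1
  · have hr1 : 1 ≤ √(r : ℝ) := by
      rw [Real.one_le_sqrt]; exact_mod_cast hr
    rcases min_cases ν (frobNorm L) with ⟨e, -⟩ | ⟨e, -⟩ <;> rw [e]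
    · linarith
    · nlinarith [frobNorm_nonneg L]

end NuclearMinimizer

section Nets

/-! ### Nets and operator norms of compressed matrices -/

/-- A maximal `1`-separated subset of the ball of radius `2` is a net of at most `5 ^ dim`
points. -/
lemma exists_finset_net (E : Type*) [NormedAddCommGroup E] [NormedSpace ℝ E]
    [FiniteDimensional ℝ E] :
    ∃ s : Finset E, s.card ≤ 5 ^ Module.finrank ℝ E ∧ (∀ c ∈ s, ‖c‖ ≤ 2) ∧
      ∀ x, ‖x‖ ≤ 2 → ∃ c ∈ s, ‖x - c‖ ≤ 1 := by
  classical
  let good : Finset E → Prop := fun s => (∀ c ∈ s, ‖c‖ ≤ 2) ∧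
    ∀ c ∈ s, ∀ d ∈ s, c ≠ d → 1 ≤ ‖c - d‖
  have hbd : ∀ s, good s → s.card ≤ 5 ^ Module.finrank ℝ E := fun s hs =>
    Besicovitch.card_le_of_separated s hs.1 hs.2
  let A : Set ℕ := {k | ∃ s, good s ∧ s.card = k}
  have hA : A.Nonempty := ⟨0, ∅, by simp [good], rfl⟩
  have hAb : BddAbove A := ⟨5 ^ Module.finrank ℝ E, by rintro k ⟨s, hs, rfl⟩; exact hbd s hs⟩
  obtain ⟨s, hs, hcard⟩ := Nat.sSup_mem hA hAb
  refine ⟨s, hbd s hs, hs.1, fun x hx => ?_⟩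
  by_contra! hfar
  have hxs : x ∉ s := fun h => by
    have := hfar x h
    rw [sub_self, norm_zero] at this
    linarith
  have hgood : good (insert x s) := by
    refine ⟨fun c hc => ?_, fun c hc d hd hcd => ?_⟩
    · rcases Finset.mem_insert.1 hc with rfl | hc
      · exact hx
      · exact hs.1 c hc
    · rcases Finset.mem_insert.1 hc with rfl | hc' <;> rcases Finset.mem_insert.1 hd with rfl | hd'
      · exact absurd rfl hcd
      · exact (hfar _ hd').le
      · rw [norm_sub_rev]; exact (hfar _ hc').le
      · exact hs.2 c hc' d hd' hcd
  have h1 : (insert x s).card ≤ sSup A := le_csSup hAb ⟨_, hgood, rfl⟩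
  rw [Finset.card_insert_of_notMem hxs, hcard] at h1
  omega

lemma Submodule.exists_finset_net {E : Type*} [NormedAddCommGroup E] [NormedSpace ℝ E]
    [FiniteDimensional ℝ E] (K : Submodule ℝ E) :
    ∃ s : Finset E, s.card ≤ 5 ^ Module.finrank ℝ K ∧ (∀ c ∈ s, c ∈ K ∧ ‖c‖ ≤ 2) ∧
      ∀ x ∈ K, ‖x‖ ≤ 2 → ∃ c ∈ s, ‖x - c‖ ≤ 1 := by
  classical
  obtain ⟨s, h1, h2, h3⟩ := _root_.exists_finset_net K
  refine ⟨s.image Subtype.val, Finset.card_image_le.trans h1, fun c hc => ?_, fun x hx hx2 => ?_⟩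
  · obtain ⟨d, hd, rfl⟩ := Finset.mem_image.1 hc
    exact ⟨d.2, h2 d hd⟩
  · obtain ⟨c, hc, hxc⟩ := h3 ⟨x, hx⟩ hx2
    exact ⟨c, Finset.mem_image_of_mem _ hc, hxc⟩

variable {m n : ℕ}

lemma IsOrthProj.toEuclideanLin_eq_self {P : Matrix (Fin m) (Fin m) ℝ} (hP : IsOrthProj P)
    {x : EuclideanSpace ℝ (Fin m)} (hx : x ∈ LinearMap.range P.toEuclideanLin) :
    P.toEuclideanLin x = x := by
  obtain ⟨y, rfl⟩ := hx
  rw [← toEuclideanLin_mul, hP.idem]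

/-- The operator norm of the compression `P * B * Q` is bounded by the bilinear form of `B` on nets
of the ranges of `P` and `Q`. -/
lemma IsOrthProj.norm_compression_le {P : Matrix (Fin m) (Fin m) ℝ}
    {Q : Matrix (Fin n) (Fin n) ℝ} (hP : IsOrthProj P) (hQ : IsOrthProj Q)
    {s : Finset (EuclideanSpace ℝ (Fin m))} {t : Finset (EuclideanSpace ℝ (Fin n))}
    (hs : ∀ c ∈ s, c ∈ LinearMap.range P.toEuclideanLin)
    (hs' : ∀ x ∈ LinearMap.range P.toEuclideanLin, ‖x‖ ≤ 2 → ∃ c ∈ s, ‖x - c‖ ≤ 1)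
    (ht : ∀ c ∈ t, c ∈ LinearMap.range Q.toEuclideanLin)
    (ht' : ∀ x ∈ LinearMap.range Q.toEuclideanLin, ‖x‖ ≤ 2 → ∃ c ∈ t, ‖x - c‖ ≤ 1)
    (B : Matrix (Fin m) (Fin n) ℝ) {c : ℝ} (hc : 0 ≤ c)
    (h : ∀ u ∈ s, ∀ v ∈ t, ⟪u, B.toEuclideanLin v⟫ ≤ c) : ‖P * B * Q‖ ≤ c := by
  set D := P * B * Q with hD
  have hDx : ∀ x, D.toEuclideanLin x = P.toEuclideanLin (B.toEuclideanLin (Q.toEuclideanLin x)) :=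
    fun x => by rw [hD, toEuclideanLin_mul, toEuclideanLin_mul]
  have hDQ : ∀ x, D.toEuclideanLin (Q.toEuclideanLin x) = D.toEuclideanLin x := fun x => by
    rw [hDx, hQ.toEuclideanLin_eq_self (LinearMap.mem_range_self _ x), ← hDx]
  have hnet : ∀ v ∈ t, ‖D.toEuclideanLin v‖ ≤ c := by
    intro v hv
    set y := D.toEuclideanLin v with hy
    have hyr : y ∈ LinearMap.range P.toEuclideanLin := by
      rw [hy, hDx]; exact LinearMap.mem_range_self _ _
    rcases (norm_nonneg y).eq_or_lt with h0 | h0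
    · rw [← h0]; exact hc
    set x := (2 * ‖y‖⁻¹) • y with hx
    have hxn : ‖x‖ = 2 := by
      rw [hx, norm_smul, norm_mul, norm_inv, norm_norm, mul_assoc, inv_mul_cancel₀ h0.ne']
      norm_num
    obtain ⟨u, hu, hxu⟩ := hs' x (Submodule.smul_mem _ _ hyr) hxn.le
    have h1 : ⟪x, y⟫ = 2 * ‖y‖ := by
      rw [hx, inner_smul_left, real_inner_self_eq_norm_sq]
      simp only [conj_trivial]; field_simp
    have h2 : ⟪u, y⟫ ≤ c := by
      have : ⟪u, y⟫ = ⟪u, B.toEuclideanLin v⟫ := by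
        rw [hy, hDx, hQ.toEuclideanLin_eq_self (ht v hv), ← inner_toEuclideanLin_transpose, hP.symm,
          hP.toEuclideanLin_eq_self (hs u hu)]
      rw [this]; exact h u hu v hv
    have h3 : ⟪x - u, y⟫ ≤ ‖y‖ :=
      (real_inner_le_norm _ _).trans (mul_le_of_le_one_left h0.le hxu)
    rw [inner_sub_left] at h3
    linarith
  -- a bound `c` on the net gives `2 ‖D‖ ≤ c + ‖D‖`
  have hball : ∀ x, ‖x‖ ≤ 2 → ‖D.toEuclideanLin x‖ ≤ c + ‖D‖ := by
    intro x hx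
    have hQx : ‖Q.toEuclideanLin x‖ ≤ 2 :=
      (norm_toEuclideanLin_le Q x).trans
        ((mul_le_of_le_one_left (norm_nonneg _) hQ.norm_le_one).trans hx)
    obtain ⟨v, hv, hxv⟩ := ht' _ (LinearMap.mem_range_self _ x) hQx
    have h1 : D.toEuclideanLin x = D.toEuclideanLin v
        + D.toEuclideanLin (Q.toEuclideanLin x - v) := by
      rw [map_sub, hDQ]; abel
    rw [h1]
    refine (norm_add_le _ _).trans (add_le_add (hnet v hv) ?_)
    exact (norm_toEuclideanLin_le D _).trans (mul_le_of_le_one_right (norm_nonneg _) hxv)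
  have h2 : ‖D‖ ≤ (c + ‖D‖) / 2 := by
    refine l2_opNorm_le D (by positivity) fun x => ?_
    rcases (norm_nonneg x).eq_or_lt with h0 | h0
    · rw [norm_eq_zero.1 h0.symm]; simp
    have := hball ((2 * ‖x‖⁻¹) • x) (by
      rw [norm_smul, norm_mul, norm_inv, norm_norm, mul_assoc, inv_mul_cancel₀ h0.ne']; norm_num)
    rw [map_smul, norm_smul, norm_mul, norm_inv, norm_norm] at this
    have e : ‖(2 : ℝ)‖ = 2 := by norm_num
    rw [e] at this
    have h3 : ‖D.toEuclideanLin x‖ = (2 * ‖x‖⁻¹ * ‖D.toEuclideanLin x‖) * (‖x‖ / 2) := by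
      field_simp
    rw [h3]
    have := mul_le_mul_of_nonneg_right this (by positivity : 0 ≤ ‖x‖ / 2)
    linarith
  linarith

end Nets

section Noise

/-! ### Operator norm of sub-Gaussian noise -/

variable {Ω : Type*} [MeasurableSpace Ω] {μ : Measure Ω} [IsProbabilityMeasure μ] {N T : ℕ}

/-- Chernoff's bound for the bilinear form of a noise matrix with independent sub-Gaussian
entries. -/
lemma measureReal_inner_noise_ge_le {ε : Ω → Fin N → Fin T → ℝ} (hε : Measurable ε)
    (hind : iIndepFun (fun (p : Fin N × Fin T) ω => ε ω p.1 p.2) μ) {a : ℝ} (ha : 0 ≤ a)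
    (hsub : ∀ i t, ∀ s : ℝ, Integrable (fun ω => Real.exp (s * ε ω i t)) μ ∧
      ∫ ω, Real.exp (s * ε ω i t) ∂μ ≤ Real.exp (a * s ^ 2))
    {u : EuclideanSpace ℝ (Fin N)} {v : EuclideanSpace ℝ (Fin T)} (hu : ‖u‖ ≤ 2) (hv : ‖v‖ ≤ 2)
    {l : ℝ} (hl : 0 ≤ l) (c : ℝ) :
    μ.real {ω | c ≤ ⟪u, (Matrix.of (ε ω)).toEuclideanLin v⟫}
      ≤ Real.exp (-l * c + 16 * a * l ^ 2) := by
  set X : Fin N × Fin T → Ω → ℝ := fun p ω => (u p.1 * v p.2) * ε ω p.1 p.2 with hX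
  have hXm : ∀ p, Measurable (X p) := fun p => by
    have : Measurable fun ω => ε ω p.1 p.2 := by fun_prop
    exact this.const_mul _
  have hXi : iIndepFun X μ := by
    have := hind.comp (fun p x => (u p.1 * v p.2) * x) (fun p => measurable_const_mul _)
    exact this
  have hsum : ∀ ω, ⟪u, (Matrix.of (ε ω)).toEuclideanLin v⟫ = (∑ p, X p) ω := by
    intro ω
    rw [Finset.sum_apply, Fintype.sum_prod_type, PiLp.inner_apply]
    refine Finset.sum_congr rfl fun i _ => ?_
    rw [Matrix.ofLp_toLpLin, Matrix.toLin'_apply, Matrix.mulVec, dotProduct]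
    simp only [hX, RCLike.inner_apply, conj_trivial, Matrix.of_apply, Finset.sum_mul]
    refine Finset.sum_congr rfl fun t _ => by ring
  have hint : ∀ p, Integrable (fun ω => Real.exp (l * X p ω)) μ := fun p => by
    have := (hsub p.1 p.2 (l * (u p.1 * v p.2))).1
    simpa only [hX, mul_assoc] using this
  have hmgf : ∀ p, mgf (X p) μ l ≤ Real.exp (a * l ^ 2 * (u p.1 ^ 2 * v p.2 ^ 2)) := fun p => by
    have h := (hsub p.1 p.2 (l * (u p.1 * v p.2))).2
    have e : a * (l * (u p.1 * v p.2)) ^ 2 = a * l ^ 2 * (u p.1 ^ 2 * v p.2 ^ 2) := by ring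
    rw [e] at h
    simpa only [mgf, hX, mul_assoc] using h
  have hch := measure_ge_le_exp_mul_mgf (μ := μ) (X := ∑ p, X p) c hl
    (by
      have := hXi.integrable_exp_mul_sum hXm (s := Finset.univ) (t := l) fun p _ => hint p
      exact this)
  simp only [hsum]
  refine hch.trans ?_
  rw [hXi.mgf_sum hXm, Real.exp_add]
  refine mul_le_mul_of_nonneg_left ?_ (Real.exp_nonneg _)
  refine (Finset.prod_le_prod (fun p _ => mgf_nonneg) fun p _ => hmgf p).trans ?_
  rw [← Real.exp_sum, Real.exp_le_exp, ← Finset.mul_sum, Fintype.sum_prod_type]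
  have hnu : ∑ i, u i ^ 2 ≤ 4 := by
    have := EuclideanSpace.norm_sq_eq u
    simp only [Real.norm_eq_abs, sq_abs] at this
    rw [← this]; nlinarith [norm_nonneg u]
  have hnv : ∑ t, v t ^ 2 ≤ 4 := by
    have := EuclideanSpace.norm_sq_eq v
    simp only [Real.norm_eq_abs, sq_abs] at this
    rw [← this]; nlinarith [norm_nonneg v]
  have hprod : ∑ i, ∑ t, u i ^ 2 * v t ^ 2 ≤ 16 := by
    rw [← Finset.sum_mul_sum]
    have := mul_le_mul hnu hnv (Finset.sum_nonneg fun _ _ => sq_nonneg _) (by norm_num)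
    linarith
  have := mul_le_mul_of_nonneg_left hprod (mul_nonneg ha (sq_nonneg l))
  linarith

/-- The noise compressed to subspaces of total dimension at most `k` has operator norm of order
`√k`, outside an event of probability `exp (-k)`. -/
lemma measure_norm_compressed_noise_gt_le {ε : Ω → Fin N → Fin T → ℝ} (hε : Measurable ε)
    (hind : iIndepFun (fun (p : Fin N × Fin T) ω => ε ω p.1 p.2) μ) {a : ℝ} (ha : 0 ≤ a)
    (hsub : ∀ i t, ∀ s : ℝ, Integrable (fun ω => Real.exp (s * ε ω i t)) μ ∧
      ∫ ω, Real.exp (s * ε ω i t) ∂μ ≤ Real.exp (a * s ^ 2))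
    {P : Matrix (Fin N) (Fin N) ℝ} {Q : Matrix (Fin T) (Fin T) ℝ} (hP : IsOrthProj P)
    (hQ : IsOrthProj Q) {k : ℝ} (hk : P.trace + Q.trace ≤ k) :
    μ {ω | (3 + 16 * a) * √k < ‖P * Matrix.of (ε ω) * Q‖} ≤ ENNReal.ofReal (Real.exp (-k)) := by
  have hk0 : 0 ≤ k := (add_nonneg hP.trace_nonneg hQ.trace_nonneg).trans hk
  obtain ⟨s, hsc, hs, hs'⟩ := (LinearMap.range P.toEuclideanLin).exists_finset_net
  obtain ⟨t, htc, ht, ht'⟩ := (LinearMap.range Q.toEuclideanLin).exists_finset_net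
  set c := (3 + 16 * a) * √k with hc
  have hsubset : {ω | c < ‖P * Matrix.of (ε ω) * Q‖} ⊆
      ⋃ p ∈ s ×ˢ t, {ω | c ≤ ⟪p.1, (Matrix.of (ε ω)).toEuclideanLin p.2⟫} := by
    intro ω hω
    by_contra hcon
    simp only [Set.mem_iUnion, Set.mem_ofPred_eq, not_exists, not_le, Finset.mem_product] at hcon
    rw [Set.mem_ofPred_eq] at hω
    refine absurd hω (not_lt.2 ?_)
    exact hP.norm_compression_le hQ (fun c hc => (hs c hc).1) hs' (fun c hc => (ht c hc).1) ht' _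
      (by positivity) fun u hu v hv => (hcon (u, v) ⟨hu, hv⟩).le
  -- with `16 * a * k` spent by Chernoff's bound at slope `√k`, the constant `3` leaves `-3 * k`,
  -- of which the `5 ^ (dim + dim) ≤ exp (2 * k)` points of the nets take two
  have hone : ∀ p ∈ s ×ˢ t, μ.real {ω | c ≤ ⟪p.1, (Matrix.of (ε ω)).toEuclideanLin p.2⟫}
      ≤ Real.exp (-3 * k) := by
    intro p hp
    obtain ⟨h1, h2⟩ := Finset.mem_product.1 hp
    refine (measureReal_inner_noise_ge_le hε hind ha hsub (hs _ h1).2 (ht _ h2).2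
      (Real.sqrt_nonneg k) c).trans (le_of_eq ?_)
    congr 1
    have : √k * √k = k := Real.mul_self_sqrt hk0
    have h2 : √k ^ 2 = k := Real.sq_sqrt hk0
    rw [hc, h2]
    linear_combination (-(3 + 16 * a)) * this
  have hcard : ((s ×ˢ t).card : ℝ) ≤ Real.exp (2 * k) := by
    have h1 : ((s ×ˢ t).card : ℝ) ≤ 5 ^ (Module.finrank ℝ (LinearMap.range P.toEuclideanLin)
        + Module.finrank ℝ (LinearMap.range Q.toEuclideanLin)) := by
      rw [Finset.card_product, pow_add]
      exact_mod_cast Nat.mul_le_mul hsc htc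
    refine h1.trans ?_
    have h5 : (5 : ℝ) ≤ Real.exp 2 := by
      have := Real.exp_one_gt_d9
      have e : Real.exp 2 = Real.exp 1 * Real.exp 1 := by rw [← Real.exp_add]; norm_num
      rw [e]; nlinarith
    refine (pow_le_pow_left₀ (by norm_num) h5 _).trans ?_
    rw [← Real.exp_nat_mul, Real.exp_le_exp]
    push_cast
    rw [hP.finrank_range, hQ.finrank_range]
    linarith
  rw [← ENNReal.ofReal_toReal (measure_ne_top μ _)]
  refine ENNReal.ofReal_le_ofReal ?_
  change μ.real _ ≤ _
  calc μ.real {ω | c < ‖P * Matrix.of (ε ω) * Q‖}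
      ≤ μ.real (⋃ p ∈ s ×ˢ t, {ω | c ≤ ⟪p.1, (Matrix.of (ε ω)).toEuclideanLin p.2⟫}) :=
        measureReal_mono hsubset (measure_ne_top _ _)
    _ ≤ ∑ p ∈ s ×ˢ t, μ.real {ω | c ≤ ⟪p.1, (Matrix.of (ε ω)).toEuclideanLin p.2⟫} :=
        measureReal_biUnion_finset_le _ _
    _ ≤ (s ×ˢ t).card • Real.exp (-3 * k) := Finset.sum_le_card_nsmul _ _ _ hone
    _ ≤ Real.exp (2 * k) * Real.exp (-3 * k) := by
        rw [nsmul_eq_mul]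
        exact mul_le_mul_of_nonneg_right hcard (Real.exp_nonneg _)
    _ = Real.exp (-k) := by rw [← Real.exp_add]; ring_nf

/-- Freezing an independent variable: a bound on every section of an event bounds the event. -/
lemma ProbabilityTheory.IndepFun.measure_mem_le {α β : Type*} [MeasurableSpace α]
    [MeasurableSpace β] {f : Ω → α} {g : Ω → β} (hfg : IndepFun f g μ) (hf : Measurable f)
    (hg : Measurable g) {A : Set (α × β)} (hA : MeasurableSet A) {δ : ENNReal}
    (h : ∀ y, μ {ω | (f ω, y) ∈ A} ≤ δ) : μ {ω | (f ω, g ω) ∈ A} ≤ δ := by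
  have h1 : μ {ω | (f ω, g ω) ∈ A} = μ.map (fun ω => (f ω, g ω)) A := by
    rw [Measure.map_apply (hf.prodMk hg) hA]; rfl
  have : IsProbabilityMeasure (μ.map g) := Measure.isProbabilityMeasure_map hg.aemeasurable
  have : IsProbabilityMeasure (μ.map f) := Measure.isProbabilityMeasure_map hf.aemeasurable
  rw [h1, hfg.map_prod_eq_prod_map_map hf.aemeasurable hg.aemeasurable, Measure.prod_apply_symm hA]
  calc ∫⁻ y, μ.map f ((fun x => (x, y)) ⁻¹' A) ∂(μ.map g) ≤ ∫⁻ _, δ ∂(μ.map g) := by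
        refine lintegral_mono fun y => ?_
        rw [Measure.map_apply hf (measurable_prodMk_right hA)]
        exact h y
    _ = δ := by simp

end Noise

section Sieve

/-! ### The sieve projections -/

variable {m : ℕ} {ι : Type*} [Fintype ι] [DecidableEq ι]

/-- This holds for every `F`: if `Fᵀ * F` is singular, its inverse is the junk value `0` and
`projMatrix F = 0`. -/
lemma isOrthProj_projMatrix (F : Matrix (Fin m) ι ℝ) : IsOrthProj (projMatrix F) where
  symm := by
    simp only [projMatrix, Matrix.transpose_mul, Matrix.transpose_transpose,
      Matrix.transpose_nonsing_inv, Matrix.mul_assoc]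
  idem := by
    unfold projMatrix
    by_cases h : IsUnit (Fᵀ * F).det
    · have : F * (Fᵀ * F)⁻¹ * Fᵀ * (F * (Fᵀ * F)⁻¹ * Fᵀ)
          = F * ((Fᵀ * F)⁻¹ * (Fᵀ * F)) * (Fᵀ * F)⁻¹ * Fᵀ := by
        simp only [Matrix.mul_assoc]
      rw [this, Matrix.nonsing_inv_mul _ h, Matrix.mul_one]
    · rw [Matrix.nonsing_inv_apply_not_isUnit _ h]; simp

lemma trace_projMatrix_le (F : Matrix (Fin m) ι ℝ) :
    (projMatrix F).trace ≤ Fintype.card ι := by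
  unfold projMatrix
  rw [Matrix.mul_assoc, Matrix.trace_mul_comm, Matrix.mul_assoc]
  by_cases h : IsUnit (Fᵀ * F).det
  · rw [Matrix.nonsing_inv_mul _ h, Matrix.trace_one]
  · rw [Matrix.nonsing_inv_apply_not_isUnit _ h]; simp

lemma projMatrix_mul_self {F : Matrix (Fin m) ι ℝ} (h : IsUnit (Fᵀ * F).det) :
    projMatrix F * F = F := by
  unfold projMatrix
  rw [Matrix.mul_assoc, Matrix.mul_assoc, Matrix.nonsing_inv_mul _ h, Matrix.mul_one]

/-- A Gram matrix, possibly rescaled, whose smallest singular value is positive is invertible. -/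
lemma isUnit_det_gram_of_lt_lambdaMin [Nonempty ι] {F : Matrix (Fin m) ι ℝ} {a c : ℝ} (hc : 0 ≤ c)
    (h : c < lambdaMin (a • (Fᵀ * F))) : IsUnit (Fᵀ * F).det := by
  have hinj : Function.Injective (a • (Fᵀ * F)).toEuclideanLin := by
    rw [LinearMap.injective_iff_forall_lt_finrank_singularValues_pos]
    intro i hi
    rw [finrank_euclideanSpace] at hi
    exact (hc.trans_lt h).trans_le (LinearMap.singularValues_antitone _ (Nat.le_sub_one_of_lt hi))
  rw [isUnit_iff_ne_zero]
  intro hdet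
  obtain ⟨v, hv0, hv⟩ := Matrix.exists_mulVec_eq_zero_iff.2 hdet
  have h1 : (a • (Fᵀ * F)).toEuclideanLin (WithLp.toLp 2 v) = 0 := by
    simp [Matrix.toLpLin_apply, hv]
  have h2 := hinj (h1.trans (map_zero _).symm)
  exact hv0 (by simpa using h2)

lemma card_le_of_isUnit_det_gram {F : Matrix (Fin m) ι ℝ} (h : IsUnit (Fᵀ * F).det) :
    Fintype.card ι ≤ m := by
  have h1 := Matrix.rank_of_isUnit (Fᵀ * F) ((Matrix.isUnit_iff_isUnit_det _).2 h)
  have h2 := Matrix.rank_mul_le_right Fᵀ F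
  have h3 := Matrix.rank_le_card_height F
  rw [Fintype.card_fin] at h3
  omega

lemma frobNorm_le_of_abs_le {m n : ℕ} {A : Matrix (Fin m) (Fin n) ℝ} {η : ℝ} (hη : 0 ≤ η)
    (h : ∀ i t, |A i t| ≤ η) : frobNorm A ≤ √((m : ℝ) * n) * η := by
  refine le_of_sq_le_sq ?_ (by positivity)
  rw [frobNorm_sq, mul_pow, Real.sq_sqrt (by positivity)]
  calc ∑ i, ∑ t, A i t ^ 2 ≤ ∑ _i : Fin m, ∑ _t : Fin n, η ^ 2 :=
        Finset.sum_le_sum fun i _ => Finset.sum_le_sum fun t _ => by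
          rw [← sq_abs]; exact pow_le_pow_left₀ (abs_nonneg _) (h i t) 2
    _ = _ := by simp; ring

/-- Functions uniformly within `η` of the span of the sieve are almost annihilated by the
complementary projection. -/
lemma frobNorm_compl_projMatrix_mul_le {K : ℕ} {F : Matrix (Fin m) ι ℝ}
    (hF : IsUnit (Fᵀ * F).det) (G : Matrix (Fin m) (Fin K) ℝ) {η : ℝ} (hη : 0 ≤ η)
    (h : ∀ k, ∃ b : ι → ℝ, ∀ i, |G i k - ∑ p, b p * F i p| ≤ η) :
    frobNorm ((1 - projMatrix F) * G) ≤ √((m : ℝ) * K) * η := by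
  choose b hb using h
  set B : Matrix ι (Fin K) ℝ := Matrix.of fun p k => b k p with hB
  have e : (1 - projMatrix F) * G = (1 - projMatrix F) * (G - F * B) := by
    have : (1 - projMatrix F) * (F * B) = 0 := by
      rw [← Matrix.mul_assoc, Matrix.sub_mul, projMatrix_mul_self hF, Matrix.one_mul, sub_self,
        Matrix.zero_mul]
    rw [Matrix.mul_sub, this, sub_zero]
  rw [e]
  refine ((isOrthProj_projMatrix F).compl.frobNorm_mul_left_le _).trans
    (frobNorm_le_of_abs_le hη fun i k => ?_)
  have : (G - F * B) i k = G i k - ∑ p, b k p * F i p := by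
    simp [Matrix.mul_apply, hB, mul_comm]
  rw [this]
  exact hb k i

/-! ### Measurability of matrix expressions -/

section Measurability
variable {α : Type*} [MeasurableSpace α]

lemma measurable_matrix_mul_apply {l n k : Type*} [Fintype n] {f : α → Matrix l n ℝ}
    {g : α → Matrix n k ℝ} (hf : ∀ i j, Measurable fun a => f a i j)
    (hg : ∀ i j, Measurable fun a => g a i j) (i : l) (j : k) :
    Measurable fun a => (f a * g a) i j := by
  simp only [Matrix.mul_apply]
  exact Finset.measurable_sum _ fun p _ => (hf i p).mul (hg p j)

lemma measurable_matrix_det {f : α → Matrix ι ι ℝ} (hf : ∀ i j, Measurable fun a => f a i j) :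
    Measurable fun a => (f a).det := by
  simp only [Matrix.det_apply]
  exact Finset.measurable_sum _ fun σ _ =>
    (Finset.measurable_prod _ fun p _ => hf _ _).const_smul _

lemma measurable_matrix_inv_apply {f : α → Matrix ι ι ℝ} (hf : ∀ i j, Measurable fun a => f a i j)
    (i j : ι) : Measurable fun a => (f a)⁻¹ i j := by
  simp only [Matrix.inv_def, Matrix.smul_apply, Ring.inverse_eq_inv', smul_eq_mul,
    Matrix.adjugate_apply]
  refine (measurable_matrix_det hf).inv.mul (measurable_matrix_det fun p q => ?_)
  by_cases h : p = j
  · subst h; simp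
  · simpa [Matrix.updateRow_ne h] using hf p q

lemma measurable_projMatrix_apply {f : α → Matrix (Fin m) ι ℝ}
    (hf : ∀ i j, Measurable fun a => f a i j) (i j : Fin m) :
    Measurable fun a => projMatrix (f a) i j := by
  have hf' : ∀ i j, Measurable fun a => (f a)ᵀ i j := fun i j => hf j i
  exact measurable_matrix_mul_apply (measurable_matrix_mul_apply hf
    (measurable_matrix_inv_apply (measurable_matrix_mul_apply hf' hf))) hf' i j

lemma measurable_matrix_norm {n : ℕ} {f : α → Matrix (Fin m) (Fin n) ℝ}
    (hf : ∀ i j, Measurable fun a => f a i j) : Measurable fun a => ‖f a‖ := by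
  have hc : Continuous fun x : Fin m → Fin n → ℝ => ‖Matrix.of x‖ := by
    have : Continuous fun A : Matrix (Fin m) (Fin n) ℝ => ‖A‖ := continuous_norm
    exact this
  have hm : Measurable fun a => (fun i j => f a i j : Fin m → Fin n → ℝ) :=
    measurable_pi_lambda _ fun i => measurable_pi_lambda _ fun j => hf i j
  exact hc.measurable.comp hm

end Measurability

end Sieve

section Probability

/-! ### Random projections and second moments -/

variable {Ω : Type*} [MeasurableSpace Ω] {μ : Measure Ω} [IsProbabilityMeasure μ]

/-- The noise compressed by random projections that are functions of an independent variable. -/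
lemma measure_norm_random_compressed_noise_gt_le {N T : ℕ} {β : Type*} [MeasurableSpace β]
    {ε : Ω → Fin N → Fin T → ℝ} (hε : Measurable ε) {g : Ω → β} (hg : Measurable g)
    (hindep : IndepFun ε g μ)
    (hind : iIndepFun (fun (p : Fin N × Fin T) ω => ε ω p.1 p.2) μ) {a : ℝ} (ha : 0 ≤ a)
    (hsub : ∀ i t, ∀ s : ℝ, Integrable (fun ω => Real.exp (s * ε ω i t)) μ ∧
      ∫ ω, Real.exp (s * ε ω i t) ∂μ ≤ Real.exp (a * s ^ 2))
    {P : β → Matrix (Fin N) (Fin N) ℝ} {Q : β → Matrix (Fin T) (Fin T) ℝ}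
    (hPm : ∀ i j, Measurable fun y => P y i j) (hQm : ∀ i j, Measurable fun y => Q y i j)
    (hP : ∀ y, IsOrthProj (P y)) (hQ : ∀ y, IsOrthProj (Q y)) {k : ℝ}
    (hk : ∀ y, (P y).trace + (Q y).trace ≤ k) :
    μ {ω | (3 + 16 * a) * √k < ‖P (g ω) * Matrix.of (ε ω) * Q (g ω)‖}
      ≤ ENNReal.ofReal (Real.exp (-k)) := by
  set A : Set ((Fin N → Fin T → ℝ) × β) :=
    {p | (3 + 16 * a) * √k < ‖P p.2 * Matrix.of p.1 * Q p.2‖} with hA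
  have hAm : MeasurableSet A := by
    refine measurableSet_lt measurable_const (measurable_matrix_norm ?_)
    refine measurable_matrix_mul_apply (measurable_matrix_mul_apply
      (fun i j => (hPm i j).comp measurable_snd) fun i j => ?_)
      fun i j => (hQm i j).comp measurable_snd
    have : Measurable fun p : (Fin N → Fin T → ℝ) × β => p.1 i j := by fun_prop
    exact this
  exact hindep.measure_mem_le hε hg hAm fun y =>
    measure_norm_compressed_noise_gt_le hε hind ha hsub (hP y) (hQ y) (hk y)

/-- Markov's inequality for the squared Frobenius norm of an array with bounded second moments. -/
lemma measure_sum_sq_gt_le {m K : ℕ} {f : Ω → Fin m → Fin K → ℝ} {C B : ℝ} (hB : 0 < B)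
    (hf : ∀ i k, Integrable (fun ω => f ω i k ^ 2) μ ∧ ∫ ω, f ω i k ^ 2 ∂μ ≤ C) :
    μ {ω | B * ((m : ℝ) * K) < ∑ i, ∑ k, f ω i k ^ 2} ≤ ENNReal.ofReal (C / B) := by
  rcases (by positivity : 0 ≤ (m : ℝ) * K).eq_or_lt with h0 | h0
  · have hempty : {ω | B * ((m : ℝ) * K) < ∑ i, ∑ k, f ω i k ^ 2} = ∅ := by
      ext ω
      rw [Set.mem_ofPred_eq, ← h0]
      rcases mul_eq_zero.1 h0.symm with h | h
      · have : m = 0 := by exact_mod_cast h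
        subst this; simp
      · have : K = 0 := by exact_mod_cast h
        subst this; simp
    rw [hempty]; simp
  · set Z : Ω → ℝ := fun ω => ∑ i, ∑ k, f ω i k ^ 2 with hZ
    have hZi : Integrable Z μ :=
      integrable_finsetSum _ fun i _ => integrable_finsetSum _ fun k _ => (hf i k).1
    have hZe : ∫ ω, Z ω ∂μ ≤ (m : ℝ) * K * C := by
      rw [hZ, integral_finsetSum _ fun i _ => integrable_finsetSum _ fun k _ => (hf i k).1]
      calc ∑ i, ∫ ω, ∑ k, f ω i k ^ 2 ∂μ ≤ ∑ _i : Fin m, ∑ _k : Fin K, C :=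
            Finset.sum_le_sum fun i _ => by
              rw [integral_finsetSum _ fun k _ => (hf i k).1]
              exact Finset.sum_le_sum fun k _ => (hf i k).2
        _ = _ := by simp; ring
    have hmk := mul_meas_ge_le_integral_of_nonneg (μ := μ) (f := Z)
      (Eventually.of_forall fun ω => Finset.sum_nonneg fun _ _ =>
        Finset.sum_nonneg fun _ _ => sq_nonneg _)
      hZi (B * ((m : ℝ) * K))
    have hsub : {ω | B * ((m : ℝ) * K) < Z ω} ⊆ {ω | B * ((m : ℝ) * K) ≤ Z ω} := by
      intro ω hω
      rw [Set.mem_ofPred_eq] at hω ⊢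
      exact hω.le
    refine (measure_mono hsub).trans ?_
    rw [← ENNReal.ofReal_toReal (measure_ne_top μ _)]
    refine ENNReal.ofReal_le_ofReal ?_
    rw [le_div_iff₀ hB]
    have h1 := hmk.trans hZe
    change B * ((m : ℝ) * K) * (μ _).toReal ≤ _ at h1
    nlinarith

end Probability

section FourPart

/-! ### Error of the four-part estimator at a fixed outcome -/

variable {N T K₂ K₃ K₄ : ℕ}

/-- The deterministic error bound: the four blocks cut out by `P` and `Q` are estimated separately.
In each penalized block, the low-rank components that the sieve spaces do not remove are the
signal; the other components, which the complementary projections almost annihilate, join the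
noise. -/
lemma frobNorm_fourPart_sub_le {P : Matrix (Fin N) (Fin N) ℝ} {Q : Matrix (Fin T) (Fin T) ℝ}
    (hP : IsOrthProj P) (hQ : IsOrthProj Q) {M₁ M₂ M₃ M₄ E A₂ A₃ A₄ : Matrix (Fin N) (Fin T) ℝ}
    {G₂ : Matrix (Fin N) (Fin K₂) ℝ} {H₂ : Matrix (Fin K₂) (Fin T) ℝ} (hM₂ : M₂ = G₂ * H₂)
    {G₃ : Matrix (Fin N) (Fin K₃) ℝ} {H₃ : Matrix (Fin K₃) (Fin T) ℝ} (hM₃ : M₃ = G₃ * H₃)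
    {G₄ : Matrix (Fin N) (Fin K₄) ℝ} {H₄ : Matrix (Fin K₄) (Fin T) ℝ} (hM₄ : M₄ = G₄ * H₄)
    {ν₂ ν₃ ν₄ : ℝ}
    (h₂ : IsNuclearMinimizer (P * (M₁ + M₂ + M₃ + M₄ + E) * (1 - Q)) ν₂ A₂)
    (h₃ : IsNuclearMinimizer ((1 - P) * (M₁ + M₂ + M₃ + M₄ + E) * Q) ν₃ A₃)
    (h₄ : IsNuclearMinimizer ((1 - P) * (M₁ + M₂ + M₃ + M₄ + E) * (1 - Q)) ν₄ A₄)
    (hν₂ : 2 * (‖P * E‖ + frobNorm (M₁ * (1 - Q)) + frobNorm (M₃ * (1 - Q))) ≤ ν₂)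
    (hν₃ : 2 * (‖E * Q‖ + frobNorm ((1 - P) * M₁) + frobNorm ((1 - P) * M₂)) ≤ ν₃)
    (hν₄ : 2 * (‖E‖ + frobNorm (M₁ * (1 - Q)) + frobNorm ((1 - P) * M₂)
      + frobNorm (M₃ * (1 - Q))) ≤ ν₄) :
    frobNorm (P * (M₁ + M₂ + M₃ + M₄ + E) * Q + A₂ + A₃ + A₄ - (M₁ + M₂ + M₃ + M₄)) ≤
      frobNorm (P * E * Q)
        + 4 * (√((K₂ : ℝ) + K₄) * min ν₂ (frobNorm M₂ + frobNorm (P * M₄)))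
        + 4 * (√((K₃ : ℝ) + K₄) * min ν₃ (frobNorm M₃ + frobNorm (M₄ * Q)))
        + 4 * (√(K₄ : ℝ) * min ν₄ (frobNorm M₄))
        + 2 * (frobNorm ((1 - P) * M₁) + frobNorm (M₁ * (1 - Q)) + frobNorm ((1 - P) * M₂)
          + frobNorm (M₃ * (1 - Q))) := by
  have hPc := hP.compl
  have hQc := hQ.compl
  -- the remainders in the three penalized blocks
  have r₂₁ : frobNorm (P * M₁ * (1 - Q)) ≤ frobNorm (M₁ * (1 - Q)) := by
    rw [Matrix.mul_assoc]; exact hP.frobNorm_mul_left_le _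
  have r₂₃ : frobNorm (P * M₃ * (1 - Q)) ≤ frobNorm (M₃ * (1 - Q)) := by
    rw [Matrix.mul_assoc]; exact hP.frobNorm_mul_left_le _
  have r₃₁ : frobNorm ((1 - P) * M₁ * Q) ≤ frobNorm ((1 - P) * M₁) := hQ.frobNorm_mul_right_le _
  have r₃₂ : frobNorm ((1 - P) * M₂ * Q) ≤ frobNorm ((1 - P) * M₂) := hQ.frobNorm_mul_right_le _
  have r₄₁ : frobNorm ((1 - P) * M₁ * (1 - Q)) ≤ frobNorm (M₁ * (1 - Q)) := by
    rw [Matrix.mul_assoc]; exact hPc.frobNorm_mul_left_le _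
  have r₄₂ : frobNorm ((1 - P) * M₂ * (1 - Q)) ≤ frobNorm ((1 - P) * M₂) :=
    hQc.frobNorm_mul_right_le _
  have r₄₃ : frobNorm ((1 - P) * M₃ * (1 - Q)) ≤ frobNorm (M₃ * (1 - Q)) := by
    rw [Matrix.mul_assoc]; exact hPc.frobNorm_mul_left_le _
  have op : ∀ {B : Matrix (Fin N) (Fin T) ℝ} {c : ℝ}, frobNorm B ≤ c → ‖B‖ ≤ c :=
    fun h => (l2_opNorm_le_frobNorm _).trans h
  -- signal plus remainder in each block
  set L₂ := P * (M₂ + M₄) * (1 - Q) with hL₂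
  set L₃ := (1 - P) * (M₃ + M₄) * Q with hL₃
  set L₄ := (1 - P) * M₄ * (1 - Q) with hL₄
  set R₂ := P * E * (1 - Q) + P * M₁ * (1 - Q) + P * M₃ * (1 - Q) with hR₂
  set R₃ := (1 - P) * E * Q + (1 - P) * M₁ * Q + (1 - P) * M₂ * Q with hR₃
  set R₄ := (1 - P) * E * (1 - Q) + (1 - P) * M₁ * (1 - Q) + (1 - P) * M₂ * (1 - Q)
    + (1 - P) * M₃ * (1 - Q) with hR₄
  have e₂ : P * (M₁ + M₂ + M₃ + M₄ + E) * (1 - Q) = L₂ + R₂ := by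
    rw [hL₂, hR₂]; simp only [Matrix.mul_add, Matrix.add_mul]; abel
  have e₃ : (1 - P) * (M₁ + M₂ + M₃ + M₄ + E) * Q = L₃ + R₃ := by
    rw [hL₃, hR₃]; simp only [Matrix.mul_add, Matrix.add_mul]; abel
  have e₄ : (1 - P) * (M₁ + M₂ + M₃ + M₄ + E) * (1 - Q) = L₄ + R₄ := by
    rw [hL₄, hR₄]; simp only [Matrix.mul_add, Matrix.add_mul]; abel
  rw [e₂] at h₂; rw [e₃] at h₃; rw [e₄] at h₄
  have b₂ : 2 * ‖R₂‖ ≤ ν₂ := by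
    have h1 := norm_add₃_le (a := P * E * (1 - Q)) (b := P * M₁ * (1 - Q)) (c := P * M₃ * (1 - Q))
    have h2 := hQc.norm_mul_right_le (P * E)
    linarith [op r₂₁, op r₂₃]
  have b₃ : 2 * ‖R₃‖ ≤ ν₃ := by
    have h1 := norm_add₃_le (a := (1 - P) * E * Q) (b := (1 - P) * M₁ * Q) (c := (1 - P) * M₂ * Q)
    have h2 := hPc.norm_mul_left_le (E * Q)
    rw [← Matrix.mul_assoc] at h2
    linarith [op r₃₁, op r₃₂]
  have b₄ : 2 * ‖R₄‖ ≤ ν₄ := by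
    have h1 := norm_add_le ((1 - P) * E * (1 - Q) + (1 - P) * M₁ * (1 - Q)
      + (1 - P) * M₂ * (1 - Q)) ((1 - P) * M₃ * (1 - Q))
    have h2 := norm_add₃_le (a := (1 - P) * E * (1 - Q)) (b := (1 - P) * M₁ * (1 - Q))
      (c := (1 - P) * M₂ * (1 - Q))
    have h3 := (hQc.norm_mul_right_le ((1 - P) * E)).trans (hPc.norm_mul_left_le E)
    linarith [op r₄₁, op r₄₂, op r₄₃]
  have f₂ : L₂ = (P * Matrix.fromCols G₂ G₄) * (Matrix.fromRows H₂ H₄ * (1 - Q)) := by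
    rw [hL₂, hM₂, hM₄, ← Matrix.fromCols_mul_fromRows]; simp only [Matrix.mul_assoc]
  have f₃ : L₃ = ((1 - P) * Matrix.fromCols G₃ G₄) * (Matrix.fromRows H₃ H₄ * Q) := by
    rw [hL₃, hM₃, hM₄, ← Matrix.fromCols_mul_fromRows]; simp only [Matrix.mul_assoc]
  have f₄ : L₄ = ((1 - P) * G₄) * (H₄ * (1 - Q)) := by
    rw [hL₄, hM₄]; simp only [Matrix.mul_assoc]
  have m₂ := h₂.frobNorm_sub_le_min b₂ _ _ f₂
  have m₃ := h₃.frobNorm_sub_le_min b₃ _ _ f₃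
  have m₄ := h₄.frobNorm_sub_le_min b₄ _ _ f₄
  simp only [Fintype.card_sum, Fintype.card_fin, Nat.cast_add] at m₂ m₃ m₄
  have l₂ : frobNorm L₂ ≤ frobNorm M₂ + frobNorm (P * M₄) := by
    refine (hQc.frobNorm_mul_right_le _).trans ?_
    rw [Matrix.mul_add]
    exact (frobNorm_add_le _ _).trans (by linarith [hP.frobNorm_mul_left_le M₂])
  have l₃ : frobNorm L₃ ≤ frobNorm M₃ + frobNorm (M₄ * Q) := by
    rw [hL₃, Matrix.mul_assoc]
    refine (hPc.frobNorm_mul_left_le _).trans ?_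
    rw [Matrix.add_mul]
    exact (frobNorm_add_le _ _).trans (by linarith [hQ.frobNorm_mul_right_le M₃])
  have l₄ : frobNorm L₄ ≤ frobNorm M₄ :=
    (hQc.frobNorm_mul_right_le _).trans (hPc.frobNorm_mul_left_le _)
  have w₂ := mul_le_mul_of_nonneg_left (min_le_min_left ν₂ l₂) (Real.sqrt_nonneg ((K₂ : ℝ) + K₄))
  have w₃ := mul_le_mul_of_nonneg_left (min_le_min_left ν₃ l₃) (Real.sqrt_nonneg ((K₃ : ℝ) + K₄))
  have w₄ := mul_le_mul_of_nonneg_left (min_le_min_left ν₄ l₄) (Real.sqrt_nonneg (K₄ : ℝ))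
  have hdec : P * (M₁ + M₂ + M₃ + M₄ + E) * Q + A₂ + A₃ + A₄ - (M₁ + M₂ + M₃ + M₄)
      = P * E * Q + (A₂ - L₂) + (A₃ - L₃) + (A₄ - L₄) - P * M₁ * (1 - Q) - P * M₃ * (1 - Q)
        - (1 - P) * M₁ * Q - (1 - P) * M₂ * Q - (1 - P) * M₁ * (1 - Q) - (1 - P) * M₂ * (1 - Q)
        - (1 - P) * M₃ * (1 - Q) := by
    rw [hL₂, hL₃, hL₄]
    simp only [Matrix.mul_add, Matrix.add_mul, Matrix.sub_mul, Matrix.mul_sub, Matrix.one_mul,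
      Matrix.mul_one]
    abel
  rw [hdec]
  -- every remainder occurs in at most two blocks
  refine (frobNorm_sub_le _ _).trans (le_trans (add_le_add_left (frobNorm_sub_le _ _) _) ?_)
  refine le_trans (add_le_add_left (add_le_add_left (frobNorm_sub_le _ _) _) _) ?_
  refine le_trans (add_le_add_left (add_le_add_left (add_le_add_left (frobNorm_sub_le _ _) _) _) _)
    ?_
  refine le_trans (add_le_add_left (add_le_add_left (add_le_add_left
    (add_le_add_left (frobNorm_sub_le _ _) _) _) _) _) ?_
  have n₁ := frobNorm_nonneg ((1 - P) * M₁)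
  have t₁ := frobNorm_sub_le (P * E * Q + (A₂ - L₂) + (A₃ - L₃) + (A₄ - L₄)
    - P * M₁ * (1 - Q)) (P * M₃ * (1 - Q))
  have t₂ := frobNorm_sub_le (P * E * Q + (A₂ - L₂) + (A₃ - L₃) + (A₄ - L₄)) (P * M₁ * (1 - Q))
  have t₃ := frobNorm_add_le (P * E * Q + (A₂ - L₂) + (A₃ - L₃)) (A₄ - L₄)
  have t₄ := frobNorm_add_le (P * E * Q + (A₂ - L₂)) (A₃ - L₃)
  have t₅ := frobNorm_add_le (P * E * Q) (A₂ - L₂)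
  linarith

/-- A component with one sieve-approximable factor is almost annihilated by the complementary
projection, if its other factor is bounded in mean square. -/
lemma frobNorm_compl_projMatrix_mul_factor_le {K : ℕ} {ι : Type*} [Fintype ι] [DecidableEq ι]
    {F : Matrix (Fin N) ι ℝ} (hF : IsUnit (Fᵀ * F).det) (G : Matrix (Fin N) (Fin K) ℝ)
    (H : Matrix (Fin T) (Fin K) ℝ) {η B : ℝ} (hη : 0 ≤ η) (hB : 0 ≤ B)
    (hG : ∀ k, ∃ b : ι → ℝ, ∀ i, |G i k - ∑ p, b p * F i p| ≤ η)
    (hH : ∑ t, ∑ k, H t k ^ 2 ≤ B * ((T : ℝ) * K)) :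
    frobNorm ((1 - projMatrix F) * (G * Hᵀ)) ≤ √B * η * (√((N : ℝ) * T) * K) := by
  have h1 := frobNorm_compl_projMatrix_mul_le hF G hη hG
  have h2 : frobNorm H ≤ √B * √((T : ℝ) * K) := by
    rw [← Real.sqrt_mul hB]; exact Real.sqrt_le_sqrt hH
  rw [← Matrix.mul_assoc]
  refine (frobNorm_mul_le' _ _).trans ?_
  rw [l2_opNorm_transpose]
  refine (mul_le_mul h1 ((l2_opNorm_le_frobNorm H).trans h2) (norm_nonneg _)
    (by positivity)).trans (le_of_eq ?_)
  have hK : √(K : ℝ) * √(K : ℝ) = K := Real.mul_self_sqrt (Nat.cast_nonneg K)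
  rw [Real.sqrt_mul (Nat.cast_nonneg N), Real.sqrt_mul (Nat.cast_nonneg T),
    Real.sqrt_mul (Nat.cast_nonneg N)]
  linear_combination (√B * η * √(N : ℝ) * √(T : ℝ)) * hK

lemma frobNorm_mul_compl_projMatrix_factor_le {K : ℕ} {ι : Type*} [Fintype ι] [DecidableEq ι]
    {F : Matrix (Fin T) ι ℝ} (hF : IsUnit (Fᵀ * F).det) (G : Matrix (Fin N) (Fin K) ℝ)
    (H : Matrix (Fin T) (Fin K) ℝ) {η B : ℝ} (hη : 0 ≤ η) (hB : 0 ≤ B)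
    (hH : ∀ k, ∃ b : ι → ℝ, ∀ t, |H t k - ∑ p, b p * F t p| ≤ η)
    (hG : ∑ i, ∑ k, G i k ^ 2 ≤ B * ((N : ℝ) * K)) :
    frobNorm ((G * Hᵀ) * (1 - projMatrix F)) ≤ √B * η * (√((N : ℝ) * T) * K) := by
  have h := frobNorm_compl_projMatrix_mul_factor_le hF H G hη hB hH hG
  rw [← frobNorm_transpose, mul_comm (T : ℝ)] at h
  simpa only [Matrix.transpose_mul, Matrix.transpose_transpose,
    (isOrthProj_projMatrix F).compl.symm] using h

end FourPart

namespace SideInfoModel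

/-! ### One stage of the asymptotics -/

variable {d₁ d₂ : ℕ} {Ω : Type*} [MeasurableSpace Ω] (S : SideInfoModel d₁ d₂ Ω)

lemma M₁_eq_mul (ω : Ω) : S.M₁ ω = (Matrix.of fun i k => S.g₁ k (S.x ω i))
    * (Matrix.of fun t k => S.q₁ k (S.z ω t))ᵀ := by
  ext i t; simp [M₁, Matrix.mul_apply]

lemma M₂_eq_mul (ω : Ω) :
    S.M₂ ω = (Matrix.of fun i k => S.g₂ k (S.x ω i)) * (Matrix.of (S.v₁ ω))ᵀ := by
  ext i t; simp [M₂, Matrix.mul_apply]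

lemma M₃_eq_mul (ω : Ω) :
    S.M₃ ω = (Matrix.of (S.w₁ ω)) * (Matrix.of fun t k => S.q₂ k (S.z ω t))ᵀ := by
  ext i t; simp [M₃, Matrix.mul_apply]

lemma M₄_eq_mul (ω : Ω) : S.M₄ ω = (Matrix.of (S.w₂ ω)) * (Matrix.of (S.v₂ ω))ᵀ := by
  ext i t; simp [M₄, Matrix.mul_apply]

/-- At an outcome where the noise and the sieve remainders are of their typical sizes, the error is
at most a constant times the rate. -/
lemma frobNorm_sub_le_rate {γG₁ γG₂ γQ₁ γQ₂ C₂ C₃ C₄ a b D : ℝ} {ω : Ω}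
    {Mhat : Matrix (Fin S.N) (Fin S.T) ℝ} (ha : 0 ≤ a) (hb : 0 ≤ b) (hD : 0 ≤ D)
    (hC₂ : 2 * a + 2 ≤ C₂) (hC₃ : 2 * a + 2 ≤ C₃) (hC₄ : 2 * a + 2 ≤ C₄)
    (hM : S.IsFourPartEstimate C₂ C₃ C₄ ω Mhat)
    (hPE : ‖S.PX ω * S.E ω‖ ≤ a * √(S.T : ℝ)) (hEQ : ‖S.E ω * S.PZ ω‖ ≤ a * √(S.N : ℝ))
    (hE : ‖S.E ω‖ ≤ a * √((S.N : ℝ) + S.T))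
    (hPEQ : frobNorm (S.PX ω * S.E ω * S.PZ ω) ≤ b * S.J)
    (hG₁ : frobNorm ((1 - S.PX ω) * S.M₁ ω)
      ≤ D * (√((S.N : ℝ) * S.T) * (S.K₁ / (S.J : ℝ) ^ γG₁)))
    (hQ₁ : frobNorm (S.M₁ ω * (1 - S.PZ ω))
      ≤ D * (√((S.N : ℝ) * S.T) * (S.K₁ / (S.J : ℝ) ^ γQ₁)))
    (hG₂ : frobNorm ((1 - S.PX ω) * S.M₂ ω)
      ≤ D * (√((S.N : ℝ) * S.T) * (S.K₂ / (S.J : ℝ) ^ γG₂)))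
    (hQ₂ : frobNorm (S.M₃ ω * (1 - S.PZ ω))
      ≤ D * (√((S.N : ℝ) * S.T) * (S.K₃ / (S.J : ℝ) ^ γQ₂)))
    (sG₁ : D * (√(S.T : ℝ) * S.K₁ / (S.J : ℝ) ^ γG₁) ≤ 1 / 3)
    (sQ₁ : D * (√(S.N : ℝ) * S.K₁ / (S.J : ℝ) ^ γQ₁) ≤ 1 / 3)
    (sG₂ : D * (√(S.T : ℝ) * S.K₂ / (S.J : ℝ) ^ γG₂) ≤ 1 / 3)
    (sQ₂ : D * (√(S.N : ℝ) * S.K₃ / (S.J : ℝ) ^ γQ₂) ≤ 1 / 3) :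
    frobNorm (Mhat - S.M ω)
      ≤ (b + 4 * C₂ + 4 * C₃ + 4 * C₄ + 2 * D) * S.rate γG₁ γG₂ γQ₁ γQ₂ ω := by
  obtain ⟨A₂, A₃, A₄, h₂, h₃, h₄, rfl⟩ := hM
  have hsq : √((S.N : ℝ) * S.T) = √(S.N : ℝ) * √(S.T : ℝ) := Real.sqrt_mul (Nat.cast_nonneg _) _
  have hN0 := Real.sqrt_nonneg (S.N : ℝ)
  have hT0 := Real.sqrt_nonneg (S.T : ℝ)
  have hNle : √(S.N : ℝ) ≤ √((S.N : ℝ) + S.T) :=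
    Real.sqrt_le_sqrt (le_add_of_nonneg_right (Nat.cast_nonneg _))
  have hTle : √(S.T : ℝ) ≤ √((S.N : ℝ) + S.T) :=
    Real.sqrt_le_sqrt (le_add_of_nonneg_left (Nat.cast_nonneg _))
  -- the remainders are below a third of the penalty scale, as `√(N T)` carries a factor of it
  have small : ∀ {x s t y : ℝ}, x ≤ D * (√((S.N : ℝ) * S.T) * y) → 0 ≤ s →
      √((S.N : ℝ) * S.T) = s * t → D * (t * y) ≤ 1 / 3 → x ≤ s / 3 := by
    intro x s t y hx hs hst hy
    refine hx.trans ?_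
    rw [hst]
    have := mul_le_mul_of_nonneg_left hy hs
    linarith
  simp only [mul_div_assoc] at sG₁ sQ₁ sG₂ sQ₂
  have xG₁ := small hG₁ hN0 hsq sG₁
  have xQ₁ := small hQ₁ hT0 (hsq.trans (mul_comm _ _)) sQ₁
  have xG₂ := small hG₂ hN0 hsq sG₂
  have xQ₂ := small hQ₂ hT0 (hsq.trans (mul_comm _ _)) sQ₂
  have k₂ := mul_le_mul_of_nonneg_right hC₂ hT0
  have k₃ := mul_le_mul_of_nonneg_right hC₃ hN0
  have k₄ := mul_le_mul_of_nonneg_right hC₄ (Real.sqrt_nonneg ((S.N : ℝ) + S.T))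
  have hP : IsOrthProj (S.PX ω) := isOrthProj_projMatrix _
  have hQ : IsOrthProj (S.PZ ω) := isOrthProj_projMatrix _
  have main := frobNorm_fourPart_sub_le (M₁ := S.M₁ ω) (E := S.E ω) hP hQ (S.M₂_eq_mul ω)
    (S.M₃_eq_mul ω) (S.M₄_eq_mul ω) h₂ h₃ h₄
    (by linarith) (by linarith) (by linarith)
  -- a tuning constant of at least one may be pulled out of the minimum
  have hmin : ∀ {c s y : ℝ}, 1 ≤ c → 0 ≤ y → min (c * s) y ≤ c * min s y := by
    intro c s y hc hy
    rw [mul_min_of_nonneg _ _ (by linarith : 0 ≤ c)]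
    exact min_le_min_left _ (le_mul_of_one_le_left hy hc)
  have y₂ : 0 ≤ frobNorm (S.M₂ ω) + frobNorm (S.PX ω * S.M₄ ω) :=
    add_nonneg (frobNorm_nonneg _) (frobNorm_nonneg _)
  have y₃ : 0 ≤ frobNorm (S.M₃ ω) + frobNorm (S.M₄ ω * S.PZ ω) :=
    add_nonneg (frobNorm_nonneg _) (frobNorm_nonneg _)
  have z₂ := mul_le_mul_of_nonneg_left (hmin (c := C₂) (s := √(S.T : ℝ)) (by linarith) y₂)
    (Real.sqrt_nonneg ((S.K₂ : ℝ) + S.K₄))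
  have z₃ := mul_le_mul_of_nonneg_left (hmin (c := C₃) (s := √(S.N : ℝ)) (by linarith) y₃)
    (Real.sqrt_nonneg ((S.K₃ : ℝ) + S.K₄))
  have z₄ := mul_le_mul_of_nonneg_left (hmin (c := C₄) (s := √((S.N : ℝ) + S.T)) (by linarith)
    (frobNorm_nonneg (S.M₄ ω))) (Real.sqrt_nonneg (S.K₄ : ℝ))
  set R₂ := √((S.K₂ : ℝ) + S.K₄) * min √(S.T : ℝ) (frobNorm (S.M₂ ω) + frobNorm (S.PX ω * S.M₄ ω))
    with hR₂
  set R₃ := √((S.K₃ : ℝ) + S.K₄) * min √(S.N : ℝ) (frobNorm (S.M₃ ω) + frobNorm (S.M₄ ω * S.PZ ω))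
    with hR₃
  set R₄ := √(S.K₄ : ℝ) * min √((S.N : ℝ) + S.T) (frobNorm (S.M₄ ω)) with hR₄
  set R₅ := √((S.N : ℝ) * S.T) * ((S.K₁ : ℝ) / (S.J : ℝ) ^ γG₁ + (S.K₁ : ℝ) / (S.J : ℝ) ^ γQ₁
    + (S.K₂ : ℝ) / (S.J : ℝ) ^ γG₂ + (S.K₃ : ℝ) / (S.J : ℝ) ^ γQ₂) with hR₅
  have p₂ : 0 ≤ R₂ := mul_nonneg (Real.sqrt_nonneg _) (le_min hT0 y₂)
  have p₃ : 0 ≤ R₃ := mul_nonneg (Real.sqrt_nonneg _) (le_min hN0 y₃)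
  have p₄ : 0 ≤ R₄ := mul_nonneg (Real.sqrt_nonneg _) (le_min (Real.sqrt_nonneg _)
    (frobNorm_nonneg _))
  have p₅ : 0 ≤ R₅ := by positivity
  have hJ0 : (0 : ℝ) ≤ S.J := Nat.cast_nonneg _
  have hrate : S.rate γG₁ γG₂ γQ₁ γQ₂ ω = S.J + R₂ + R₃ + R₄ + R₅ := rfl
  rw [hrate]
  have hrem : frobNorm ((1 - S.PX ω) * S.M₁ ω) + frobNorm (S.M₁ ω * (1 - S.PZ ω))
      + frobNorm ((1 - S.PX ω) * S.M₂ ω) + frobNorm (S.M₃ ω * (1 - S.PZ ω)) ≤ D * R₅ := by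
    rw [hR₅]; linarith
  have hbound : frobNorm (S.PX ω * S.Y ω * S.PZ ω + A₂ + A₃ + A₄ - S.M ω)
      ≤ b * S.J + 4 * (C₂ * R₂) + 4 * (C₃ * R₃) + 4 * (C₄ * R₄) + 2 * (D * R₅) := by
    refine main.trans ?_
    rw [mul_left_comm, ← hR₂] at z₂
    rw [mul_left_comm, ← hR₃] at z₃
    rw [mul_left_comm, ← hR₄] at z₄
    linarith
  refine hbound.trans ?_
  have q₂ : 0 ≤ C₂ := by linarith
  have q₃ : 0 ≤ C₃ := by linarith
  have q₄ : 0 ≤ C₄ := by linarith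
  have expand : (b + 4 * C₂ + 4 * C₃ + 4 * C₄ + 2 * D) * (S.J + R₂ + R₃ + R₄ + R₅)
      - (b * S.J + 4 * (C₂ * R₂) + 4 * (C₃ * R₃) + 4 * (C₄ * R₄) + 2 * (D * R₅))
      = b * (R₂ + R₃ + R₄ + R₅) + 4 * C₂ * (S.J + R₃ + R₄ + R₅) + 4 * C₃ * (S.J + R₂ + R₄ + R₅)
        + 4 * C₄ * (S.J + R₂ + R₃ + R₅) + 2 * D * (S.J + R₂ + R₃ + R₄) := by ring
  have : 0 ≤ b * (R₂ + R₃ + R₄ + R₅) + 4 * C₂ * (S.J + R₃ + R₄ + R₅)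
      + 4 * C₃ * (S.J + R₂ + R₄ + R₅) + 4 * C₄ * (S.J + R₂ + R₃ + R₅)
      + 2 * D * (S.J + R₂ + R₃ + R₄) := by positivity
  linarith

/-- On the Gram event both sieve Gram matrices are invertible. -/
lemma isUnit_det_gram_of_mem_gramEvent (hd₁ : 1 ≤ d₁) (hd₂ : 1 ≤ d₂) (hJ : 1 ≤ S.J) {c C : ℝ}
    (hc : 0 < c) {ω : Ω} (hω : ω ∈ S.gramEvent c C) :
    IsUnit ((S.Phi ω)ᵀ * S.Phi ω).det ∧ IsUnit ((S.Psi ω)ᵀ * S.Psi ω).det := by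
  have : Nonempty (Fin d₁ × Fin S.J) := ⟨⟨0, hd₁⟩, ⟨0, hJ⟩⟩
  have : Nonempty (Fin d₂ × Fin S.J) := ⟨⟨0, hd₂⟩, ⟨0, hJ⟩⟩
  exact ⟨isUnit_det_gram_of_lt_lambdaMin hc.le hω.1, isUnit_det_gram_of_lt_lambdaMin hc.le hω.2.2.1⟩

/-- On the Gram event the sieve dimension is at most each sample size. -/
lemma J_le_of_mem_gramEvent (hd₁ : 1 ≤ d₁) (hd₂ : 1 ≤ d₂) (hJ : 1 ≤ S.J) {c C : ℝ}
    (hc : 0 < c) {ω : Ω} (hω : ω ∈ S.gramEvent c C) : S.J ≤ S.N ∧ S.J ≤ S.T := by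
  obtain ⟨h1, h2⟩ := S.isUnit_det_gram_of_mem_gramEvent hd₁ hd₂ hJ hc hω
  have h3 := card_le_of_isUnit_det_gram h1
  have h4 := card_le_of_isUnit_det_gram h2
  rw [Fintype.card_prod, Fintype.card_fin, Fintype.card_fin] at h3 h4
  exact ⟨(Nat.le_mul_of_pos_left _ hd₁).trans h3, (Nat.le_mul_of_pos_left _ hd₂).trans h4⟩

variable {μ : Measure Ω}

/-- Almost surely all characteristics lie in their supports. -/
lemma ae_mem_supp : ∀ᵐ ω ∂μ, (∀ i, S.x ω i ∈ S.suppX μ i) ∧ (∀ t, S.z ω t ∈ S.suppZ μ t) := by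
  have hx : ∀ i, ∀ᵐ ω ∂μ, S.x ω i ∈ S.suppX μ i := fun i => by
    have hm : Measurable fun ω => S.x ω i := (measurable_pi_apply i).comp S.measurable_x
    exact ae_of_ae_map hm.aemeasurable (μ.map fun ω => S.x ω i).support_mem_ae
  have hz : ∀ t, ∀ᵐ ω ∂μ, S.z ω t ∈ S.suppZ μ t := fun t => by
    have hm : Measurable fun ω => S.z ω t := (measurable_pi_apply t).comp S.measurable_z
    exact ae_of_ae_map hm.aemeasurable (μ.map fun ω => S.z ω t).support_mem_ae
  filter_upwards [ae_all_iff.2 hx, ae_all_iff.2 hz] with ω h1 h2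
  exact ⟨h1, h2⟩

/-- The sieve remainders, where the Gram matrices are invertible, the characteristics lie in their
supports and the random factors have typical mean squares. -/
lemma frobNorm_remainders_le {γG₁ γG₂ γQ₁ γQ₂ C B : ℝ} (hB : 0 ≤ B)
    (hS : S.SieveApprox μ γG₁ γG₂ γQ₁ γQ₂ C) {ω : Ω}
    (hΦ : IsUnit ((S.Phi ω)ᵀ * S.Phi ω).det) (hΨ : IsUnit ((S.Psi ω)ᵀ * S.Psi ω).det)
    (hx : ∀ i, S.x ω i ∈ S.suppX μ i) (hz : ∀ t, S.z ω t ∈ S.suppZ μ t)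
    (hg : ∑ i, ∑ k, S.g₁ k (S.x ω i) ^ 2 ≤ B * ((S.N : ℝ) * S.K₁))
    (hq : ∑ t, ∑ k, S.q₁ k (S.z ω t) ^ 2 ≤ B * ((S.T : ℝ) * S.K₁))
    (hv : ∑ t, ∑ k, S.v₁ ω t k ^ 2 ≤ B * ((S.T : ℝ) * S.K₂))
    (hw : ∑ i, ∑ k, S.w₁ ω i k ^ 2 ≤ B * ((S.N : ℝ) * S.K₃)) :
    frobNorm ((1 - S.PX ω) * S.M₁ ω)
      ≤ √B * |C| * (√((S.N : ℝ) * S.T) * (S.K₁ / (S.J : ℝ) ^ γG₁)) ∧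
    frobNorm (S.M₁ ω * (1 - S.PZ ω))
      ≤ √B * |C| * (√((S.N : ℝ) * S.T) * (S.K₁ / (S.J : ℝ) ^ γQ₁)) ∧
    frobNorm ((1 - S.PX ω) * S.M₂ ω)
      ≤ √B * |C| * (√((S.N : ℝ) * S.T) * (S.K₂ / (S.J : ℝ) ^ γG₂)) ∧
    frobNorm (S.M₃ ω * (1 - S.PZ ω))
      ≤ √B * |C| * (√((S.N : ℝ) * S.T) * (S.K₃ / (S.J : ℝ) ^ γQ₂)) := by
  obtain ⟨a₁, a₂, a₃, a₄⟩ := hS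
  have hJ0 : (0 : ℝ) ≤ S.J := Nat.cast_nonneg _
  have hη : ∀ γ : ℝ, 0 ≤ |C| * (S.J : ℝ) ^ (-γ) := fun γ =>
    mul_nonneg (abs_nonneg _) (Real.rpow_nonneg hJ0 _)
  have hle : ∀ {u γ : ℝ}, u ≤ C * (S.J : ℝ) ^ (-γ) → u ≤ |C| * (S.J : ℝ) ^ (-γ) := fun h =>
    h.trans (mul_le_mul_of_nonneg_right (le_abs_self C) (Real.rpow_nonneg hJ0 _))
  have hform : ∀ γ K : ℝ, √B * (|C| * (S.J : ℝ) ^ (-γ)) * (√((S.N : ℝ) * S.T) * K)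
      = √B * |C| * (√((S.N : ℝ) * S.T) * (K / (S.J : ℝ) ^ γ)) := fun γ K => by
    rw [Real.rpow_neg hJ0, div_eq_mul_inv]; ring
  refine ⟨?_, ?_, ?_, ?_⟩
  · rw [M₁_eq_mul, ← hform]
    exact frobNorm_compl_projMatrix_mul_factor_le hΦ _ _ (hη _) hB
      (fun k => (a₁ k).imp fun b hb i => hle (hb i _ (hx i))) hq
  · rw [M₁_eq_mul, ← hform]
    exact frobNorm_mul_compl_projMatrix_factor_le hΨ _ _ (hη _) hB
      (fun k => (a₃ k).imp fun b hb t => hle (hb t _ (hz t))) hg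
  · rw [M₂_eq_mul, ← hform]
    exact frobNorm_compl_projMatrix_mul_factor_le hΦ _ _ (hη _) hB
      (fun k => (a₂ k).imp fun b hb i => hle (hb i _ (hx i))) hv
  · rw [M₃_eq_mul, ← hform]
    exact frobNorm_mul_compl_projMatrix_factor_le hΨ _ _ (hη _) hB
      (fun k => (a₄ k).imp fun b hb t => hle (hb t _ (hz t))) hw

/-- The operator norms of the noise compressed by the sieve projections: each of the two sides is
either compressed or not. The bounds use `tr P_X ≤ d₁ J` and `tr P_Z ≤ d₂ J`. -/
lemma measure_norm_compressed_noise_le [IsProbabilityMeasure μ] {C₁ C₂ : ℝ} (hC₁ : 0 ≤ C₁)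
    (hC₂ : 0 ≤ C₂) (hnoise : S.NoiseCondition μ C₁ C₂) (k : ℝ) :
    ((d₁ : ℝ) * S.J + S.T ≤ k → μ {ω | (3 + 16 * (C₂ * C₁)) * √k < ‖S.PX ω * S.E ω‖}
      ≤ ENNReal.ofReal (Real.exp (-k))) ∧
    ((S.N : ℝ) + d₂ * S.J ≤ k → μ {ω | (3 + 16 * (C₂ * C₁)) * √k < ‖S.E ω * S.PZ ω‖}
      ≤ ENNReal.ofReal (Real.exp (-k))) ∧
    ((S.N : ℝ) + S.T ≤ k → μ {ω | (3 + 16 * (C₂ * C₁)) * √k < ‖S.E ω‖}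
      ≤ ENNReal.ofReal (Real.exp (-k))) ∧
    ((d₁ : ℝ) * S.J + d₂ * S.J ≤ k →
      μ {ω | (3 + 16 * (C₂ * C₁)) * √k < ‖S.PX ω * S.E ω * S.PZ ω‖}
        ≤ ENNReal.ofReal (Real.exp (-k))) := by
  obtain ⟨hind, hindep, -, σ, hσ, -, hexp⟩ := hnoise
  have hsub : ∀ i t, ∀ s : ℝ, Integrable (fun ω => Real.exp (s * S.ε ω i t)) μ ∧
      ∫ ω, Real.exp (s * S.ε ω i t) ∂μ ≤ Real.exp (C₂ * C₁ * s ^ 2) := fun i t s => by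
    refine ⟨(hexp i t s).1, (hexp i t s).2.trans (Real.exp_le_exp.2 ?_)⟩
    have := mul_le_mul_of_nonneg_left hσ (mul_nonneg hC₂ (sq_nonneg s))
    linarith
  set P : (Fin S.N → Fin d₁ → ℝ) × (Fin S.T → Fin d₂ → ℝ) → Matrix (Fin S.N) (Fin S.N) ℝ :=
    fun y => projMatrix (Matrix.of fun i p => sieveVec S.φ (y.1 i) p) with hP
  set Q : (Fin S.N → Fin d₁ → ℝ) × (Fin S.T → Fin d₂ → ℝ) → Matrix (Fin S.T) (Fin S.T) ℝ :=
    fun y => projMatrix (Matrix.of fun t p => sieveVec S.ψ (y.2 t) p) with hQ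
  have hPm : ∀ i j, Measurable fun y => P y i j := measurable_projMatrix_apply fun i p => by
    have h1 : Measurable fun y : (Fin S.N → Fin d₁ → ℝ) × (Fin S.T → Fin d₂ → ℝ) => y.1 i p.1 := by
      fun_prop
    exact (S.measurable_φ p.2).comp h1
  have hQm : ∀ i j, Measurable fun y => Q y i j := measurable_projMatrix_apply fun t p => by
    have h1 : Measurable fun y : (Fin S.N → Fin d₁ → ℝ) × (Fin S.T → Fin d₂ → ℝ) => y.2 t p.1 := by
      fun_prop
    exact (S.measurable_ψ p.2).comp h1
  have hPt : ∀ y, (P y).trace ≤ d₁ * S.J := fun y => by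
    have := trace_projMatrix_le (Matrix.of fun i p => sieveVec S.φ (y.1 i) p)
    simpa using this
  have hQt : ∀ y, (Q y).trace ≤ d₂ * S.J := fun y => by
    have := trace_projMatrix_le (Matrix.of fun t p => sieveVec S.ψ (y.2 t) p)
    simpa using this
  have hPo : ∀ y, IsOrthProj (P y) := fun y => isOrthProj_projMatrix _
  have hQo : ∀ y, IsOrthProj (Q y) := fun y => isOrthProj_projMatrix _
  have hg : Measurable fun ω => (S.x ω, S.z ω) := S.measurable_x.prodMk S.measurable_z
  have ha := mul_nonneg hC₂ hC₁
  refine ⟨fun hk => ?_, fun hk => ?_, fun hk => ?_, fun hk => ?_⟩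
  · have := measure_norm_random_compressed_noise_gt_le S.measurable_ε hg hindep hind ha hsub
      (Q := fun _ => 1) hPm (fun i j => measurable_const) hPo (fun _ => IsOrthProj.one) (k := k)
      (fun y => by rw [Matrix.trace_one, Fintype.card_fin]; linarith [hPt y])
    simp only [Matrix.mul_one] at this
    exact this
  · have := measure_norm_random_compressed_noise_gt_le S.measurable_ε hg hindep hind ha hsub
      (P := fun _ => 1) (fun i j => measurable_const) hQm (fun _ => IsOrthProj.one) hQo (k := k)
      (fun y => by rw [Matrix.trace_one, Fintype.card_fin]; linarith [hQt y])
    simp only [Matrix.one_mul] at this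
    exact this
  · have := measure_norm_random_compressed_noise_gt_le S.measurable_ε hg hindep hind ha hsub
      (P := fun _ => 1) (Q := fun _ => 1) (fun i j => measurable_const)
      (fun i j => measurable_const)
      (fun _ => IsOrthProj.one) (fun _ => IsOrthProj.one) (k := k) (fun y => by
        rw [Matrix.trace_one, Matrix.trace_one, Fintype.card_fin, Fintype.card_fin]; exact hk)
    simp only [Matrix.one_mul, Matrix.mul_one] at this
    exact this
  · exact measure_norm_random_compressed_noise_gt_le S.measurable_ε hg hindep hind ha hsub hPm hQm
      hPo hQo (k := k) (fun y => by linarith [hPt y, hQt y])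

lemma frobNorm_compressed_noise_le (ω : Ω) :
    frobNorm (S.PX ω * S.E ω * S.PZ ω) ≤ √((d₁ : ℝ) * S.J) * ‖S.PX ω * S.E ω * S.PZ ω‖ := by
  have hP : IsOrthProj (S.PX ω) := isOrthProj_projMatrix _
  have h := hP.frobNorm_mul_le_sqrt_trace (S.PX ω * S.E ω * S.PZ ω)
  rw [← Matrix.mul_assoc, ← Matrix.mul_assoc, hP.idem] at h
  refine h.trans (mul_le_mul_of_nonneg_right (Real.sqrt_le_sqrt ?_) (norm_nonneg _))
  have h2 := trace_projMatrix_le (S.Phi ω)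
  rw [Fintype.card_prod, Fintype.card_fin, Fintype.card_fin, Nat.cast_mul] at h2
  exact h2

end SideInfoModel

section Stage

/-! ### Probability of failure and the convergence rate -/

/-- Failure probability at one stage: outside the Gram event, four noise events and four
moment events, each of probability at most `δ`, the error is at most a constant times the rate. -/
lemma SideInfoModel.measure_rate_lt_frobNorm_le {d₁ d₂ : ℕ} (hd₁ : 1 ≤ d₁) (hd₂ : 1 ≤ d₂)
    {Ω : Type*} [MeasurableSpace Ω] {μ : Measure Ω} [IsProbabilityMeasure μ]
    (S : SideInfoModel d₁ d₂ Ω) {Cvar Csub C₂ C₃ C₄ γG₁ γG₂ γQ₁ γQ₂ c C Cs Cm B q δ κ Δ D : ℝ}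
    (hCvar : 0 ≤ Cvar) (hCsub : 0 ≤ Csub) (hκ : κ = 3 + 16 * (Csub * Cvar))
    (hΔ : Δ = (d₁ : ℝ) + d₂ + 2) (hD : D = √B * |Cs|) (hc : 0 < c) (hB : 0 < B) (hq : 1 ≤ q)
    (hC₂ : 2 * (κ * √Δ) + 2 ≤ C₂) (hC₃ : 2 * (κ * √Δ) + 2 ≤ C₃) (hC₄ : 2 * (κ * √Δ) + 2 ≤ C₄)
    (hJ : 1 ≤ S.J) (hJN : S.J ≤ S.N) (hJT : S.J ≤ S.T) (hNq : q ≤ S.N) (hTq : q ≤ S.T)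
    (hnoise : S.NoiseCondition μ Cvar Csub) (hsieve : S.SieveApprox μ γG₁ γG₂ γQ₁ γQ₂ Cs)
    (hmom : S.MomentCondition μ Cm)
    (sG₁ : D * (√(S.T : ℝ) * S.K₁ / (S.J : ℝ) ^ γG₁) ≤ 1 / 3)
    (sQ₁ : D * (√(S.N : ℝ) * S.K₁ / (S.J : ℝ) ^ γQ₁) ≤ 1 / 3)
    (sG₂ : D * (max √(S.N : ℝ) √(S.T : ℝ) * S.K₂ / (S.J : ℝ) ^ γG₂) ≤ 1 / 3)
    (sQ₂ : D * (max √(S.N : ℝ) √(S.T : ℝ) * S.K₃ / (S.J : ℝ) ^ γQ₂) ≤ 1 / 3)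
    (hgram : μ (S.gramEvent c C)ᶜ ≤ ENNReal.ofReal δ) (hexp : Real.exp (-q) ≤ δ)
    (hCB : Cm / B ≤ δ) {Mhat : Ω → Matrix (Fin S.N) (Fin S.T) ℝ}
    (hMhat : ∀ ω, S.IsFourPartEstimate C₂ C₃ C₄ ω (Mhat ω)) :
    μ {ω | (κ * √(d₁ * (q * Δ)) + 4 * C₂ + 4 * C₃ + 4 * C₄ + 2 * D) * S.rate γG₁ γG₂ γQ₁ γQ₂ ω
      < |frobNorm (Mhat ω - S.M ω)|} ≤ 9 * ENNReal.ofReal δ := by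
  have hκ0 : 0 ≤ κ := by rw [hκ]; positivity
  have hΔ0 : 0 ≤ Δ := by rw [hΔ]; positivity
  have hD0 : 0 ≤ D := by rw [hD]; positivity
  have hd₁0 : (0 : ℝ) ≤ d₁ := Nat.cast_nonneg _
  have hd₂0 : (0 : ℝ) ≤ d₂ := Nat.cast_nonneg _
  have hJ1 : (1 : ℝ) ≤ S.J := by exact_mod_cast hJ
  have hJ0 : (0 : ℝ) ≤ S.J := by linarith
  have hJN' : (S.J : ℝ) ≤ S.N := by exact_mod_cast hJN
  have hJT' : (S.J : ℝ) ≤ S.T := by exact_mod_cast hJT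
  have hle : ∀ {d' y : ℝ}, 0 ≤ d' → (S.J : ℝ) ≤ y → d' * S.J ≤ d' * y :=
    fun hd' hy => mul_le_mul_of_nonneg_left hy hd'
  have hexp' : ∀ y : ℝ, q ≤ y → ENNReal.ofReal (Real.exp (-(Δ * y))) ≤ ENNReal.ofReal δ := by
    intro y hy
    have h1 : y ≤ Δ * y := le_mul_of_one_le_left (by linarith) (by linarith)
    exact ENNReal.ofReal_le_ofReal ((Real.exp_le_exp.2 (by linarith)).trans hexp)
  have hCB' := ENNReal.ofReal_le_ofReal hCB
  have noise := S.measure_norm_compressed_noise_le hCvar hCsub hnoise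
  rw [← hκ] at noise
  have p₁ := ((noise (Δ * S.T)).1 (by
    rw [hΔ]; linarith [hle hd₁0 hJT', mul_nonneg hd₂0 (hJ0.trans hJT')])).trans (hexp' _ hTq)
  have p₂ := ((noise (Δ * S.N)).2.1 (by
    rw [hΔ]; linarith [hle hd₂0 hJN', mul_nonneg hd₁0 (hJ0.trans hJN')])).trans (hexp' _ hNq)
  have p₃ := ((noise (Δ * (S.N + S.T))).2.2.1
    (le_mul_of_one_le_left (by linarith) (by linarith))).trans (hexp' _ (by linarith))
  have p₄ := ((noise (Δ * (q * S.J))).2.2.2 (by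
    have h1 : (S.J : ℝ) ≤ q * S.J := le_mul_of_one_le_left hJ0 hq
    rw [hΔ]; linarith [hle hd₁0 h1, hle hd₂0 h1])).trans
      (hexp' _ (le_mul_of_one_le_right (by linarith) hJ1))
  obtain ⟨-, mg, -, mq, -, mw, -, mv, -⟩ := hmom
  have p₅ := (measure_sum_sq_gt_le (μ := μ) (f := fun ω i k => S.g₁ k (S.x ω i)) hB
    mg).trans hCB'
  have p₆ := (measure_sum_sq_gt_le (μ := μ) (f := fun ω t k => S.q₁ k (S.z ω t)) hB
    mq).trans hCB'
  have p₇ := (measure_sum_sq_gt_le (μ := μ) (f := S.v₁) hB mv).trans hCB'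
  have p₈ := (measure_sum_sq_gt_le (μ := μ) (f := S.w₁) hB mw).trans hCB'
  have hgood : ∀ᵐ ω ∂μ, (κ * √(d₁ * (q * Δ)) + 4 * C₂ + 4 * C₃ + 4 * C₄ + 2 * D)
      * S.rate γG₁ γG₂ γQ₁ γQ₂ ω < |frobNorm (Mhat ω - S.M ω)| →
      ω ∈ (S.gramEvent c C)ᶜ ∪
        ({ω | κ * √(Δ * S.T) < ‖S.PX ω * S.E ω‖} ∪
        ({ω | κ * √(Δ * S.N) < ‖S.E ω * S.PZ ω‖} ∪
        ({ω | κ * √(Δ * (S.N + S.T)) < ‖S.E ω‖} ∪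
        ({ω | κ * √(Δ * (q * S.J)) < ‖S.PX ω * S.E ω * S.PZ ω‖} ∪
        ({ω | B * ((S.N : ℝ) * S.K₁) < ∑ i, ∑ k, S.g₁ k (S.x ω i) ^ 2} ∪
        ({ω | B * ((S.T : ℝ) * S.K₁) < ∑ t, ∑ k, S.q₁ k (S.z ω t) ^ 2} ∪
        ({ω | B * ((S.T : ℝ) * S.K₂) < ∑ t, ∑ k, S.v₁ ω t k ^ 2} ∪
        {ω | B * ((S.N : ℝ) * S.K₃) < ∑ i, ∑ k, S.w₁ ω i k ^ 2}))))))) := by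
    filter_upwards [S.ae_mem_supp (μ := μ)] with ω hω hbad
    by_contra hcon
    simp only [Set.mem_union, Set.mem_compl_iff, Set.mem_ofPred_eq, not_or, not_not, not_lt] at hcon
    obtain ⟨g₀, g₁, g₂, g₃, g₄, g₅, g₆, g₇, g₈⟩ := hcon
    obtain ⟨hΦ, hΨ⟩ := S.isUnit_det_gram_of_mem_gramEvent hd₁ hd₂ hJ hc g₀
    obtain ⟨r₁, r₂, r₃, r₄⟩ :=
      S.frobNorm_remainders_le hB.le hsieve hΦ hΨ hω.1 hω.2 g₅ g₆ g₇ g₈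
    rw [← hD] at r₁ r₂ r₃ r₄
    have hmax : ∀ {s K y : ℝ}, s ≤ max √(S.N : ℝ) √(S.T : ℝ) → 0 ≤ K → 0 ≤ y →
        D * (max √(S.N : ℝ) √(S.T : ℝ) * K / y) ≤ 1 / 3 → D * (s * K / y) ≤ 1 / 3 := by
      intro s K y hs hK hy h
      refine le_trans (mul_le_mul_of_nonneg_left ?_ hD0) h
      exact div_le_div_of_nonneg_right (mul_le_mul_of_nonneg_right hs hK) hy
    have hrp : ∀ γ : ℝ, 0 ≤ (S.J : ℝ) ^ γ := fun γ => Real.rpow_nonneg (by linarith) γ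
    have hPEQ : frobNorm (S.PX ω * S.E ω * S.PZ ω) ≤ κ * √(d₁ * (q * Δ)) * S.J := by
      refine (S.frobNorm_compressed_noise_le ω).trans
        ((mul_le_mul_of_nonneg_left g₄ (Real.sqrt_nonneg _)).trans (le_of_eq ?_))
      have hJJ : √(S.J : ℝ) * √(S.J : ℝ) = S.J := Real.mul_self_sqrt (by linarith)
      rw [← mul_assoc Δ, mul_comm Δ q, Real.sqrt_mul hd₁0, Real.sqrt_mul (by positivity),
        Real.sqrt_mul hd₁0]
      linear_combination (κ * √(d₁ : ℝ) * √(q * Δ)) * hJJ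
    have hbound := S.frobNorm_sub_le_rate (mul_nonneg hκ0 (Real.sqrt_nonneg Δ))
      (mul_nonneg hκ0 (Real.sqrt_nonneg (d₁ * (q * Δ)))) hD0 hC₂ hC₃ hC₄ (hMhat ω)
      (by rw [mul_assoc, ← Real.sqrt_mul hΔ0]; exact g₁)
      (by rw [mul_assoc, ← Real.sqrt_mul hΔ0]; exact g₂)
      (by rw [mul_assoc, ← Real.sqrt_mul hΔ0]; exact g₃) hPEQ r₁ r₂ r₃ r₄ sG₁ sQ₁
      (hmax (le_max_right _ _) (Nat.cast_nonneg _) (hrp _) sG₂)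
      (hmax (le_max_left _ _) (Nat.cast_nonneg _) (hrp _) sQ₂)
    rw [abs_of_nonneg (frobNorm_nonneg _)] at hbad
    linarith
  refine (measure_mono_ae hgood).trans ?_
  have hadd : ∀ {A A' : Set Ω} {x y : ENNReal}, μ A ≤ x → μ A' ≤ y → μ (A ∪ A') ≤ x + y :=
    fun h h' => (measure_union_le _ _).trans (add_le_add h h')
  refine (hadd hgram <| hadd p₁ <| hadd p₂ <| hadd p₃ <| hadd p₄ <| hadd p₅ <| hadd p₆ <|
    hadd p₇ p₈).trans (le_of_eq ?_)
  ring

end Stage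

end

theorem theorem1 (d₁ d₂ : ℕ) (hd₁ : 1 ≤ d₁) (hd₂ : 1 ≤ d₂)
    (Cvar Csub : ℝ) (hCvar : 0 < Cvar) (hCsub : 0 < Csub) :
    ∃ C₀ : ℝ, 0 < C₀ ∧ ∀ C₂ C₃ C₄ : ℝ, C₀ ≤ C₂ → C₀ ≤ C₃ → C₀ ≤ C₄ →
      ∀ (Ω : ℕ → Type*) [∀ n, MeasurableSpace (Ω n)]
        (μ : ∀ n, Measure (Ω n)) [∀ n, IsProbabilityMeasure (μ n)]
        (S : ∀ n, SideInfoModel d₁ d₂ (Ω n))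
        (γG₁ γG₂ γQ₁ γQ₂ : ℝ),
        2 ≤ γG₁ → 2 ≤ γG₂ → 2 ≤ γQ₁ → 2 ≤ γQ₂ →
        (∀ n, 1 ≤ (S n).J) →
        Tendsto (fun n => (S n).N) atTop atTop →
        Tendsto (fun n => (S n).T) atTop atTop →
        -- noise
        (∀ n, (S n).NoiseCondition (μ n) Cvar Csub) →
        -- basis functions
        (∃ c C : ℝ, 0 < c ∧ 0 < C ∧
          WithProbApproachingOne μ (fun n => (S n).gramEvent c C)) →
        (∀ n, (S n).BasisMoments (μ n)) →
        -- sieve approximation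
        (∃ C : ℝ, ∀ᶠ n in atTop, (S n).SieveApprox (μ n) γG₁ γG₂ γQ₁ γQ₂ C) →
        Tendsto (fun n => √((S n).T : ℝ) * (S n).K₁ / ((S n).J : ℝ) ^ γG₁) atTop (𝓝 0) →
        Tendsto (fun n => √((S n).N : ℝ) * (S n).K₁ / ((S n).J : ℝ) ^ γQ₁) atTop (𝓝 0) →
        Tendsto (fun n => max √((S n).N : ℝ) √((S n).T : ℝ) * (S n).K₂ / ((S n).J : ℝ) ^ γG₂)
          atTop (𝓝 0) →
        Tendsto (fun n => max √((S n).N : ℝ) √((S n).T : ℝ) * (S n).K₃ / ((S n).J : ℝ) ^ γQ₂)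
          atTop (𝓝 0) →
        -- moments
        (∃ C : ℝ, ∀ n, (S n).MomentCondition (μ n) C) →
        ∀ Mhat : ∀ n, Ω n → Matrix (Fin (S n).N) (Fin (S n).T) ℝ,
          (∀ n ω, (S n).IsFourPartEstimate C₂ C₃ C₄ ω (Mhat n ω)) →
          IsBigOInProb μ (fun n ω => frobNorm (Mhat n ω - (S n).M ω))
            (fun n ω => (S n).rate γG₁ γG₂ γQ₁ γQ₂ ω) := by
  set κ : ℝ := 3 + 16 * (Csub * Cvar) with hκ
  set Δ : ℝ := (d₁ : ℝ) + d₂ + 2 with hΔ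
  have hκ0 : 0 ≤ κ := by positivity
  have hΔ0 : 0 ≤ Δ := by positivity
  -- the first summand covers twice the noise, the second twice the sieve remainders
  refine ⟨2 * (κ * √Δ) + 2, by positivity, ?_⟩
  intro C₂ C₃ C₄ hC₂ hC₃ hC₄ Ω _ μ _ S γG₁ γG₂ γQ₁ γQ₂ _ _ _ _ hJ hN hT hnoise hgram _ hsieve
    limG₁ limQ₁ limG₂ limQ₂ hmom Mhat hMhat δ hδ
  obtain ⟨c, C, hc, -, hgram⟩ := hgram
  obtain ⟨Cs, hsieve⟩ := hsieve
  obtain ⟨Cm, hmom⟩ := hmom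
  -- each of the nine exceptional events gets an equal share of the probability `δ`
  have hδ' : 0 < δ / 9 := by positivity
  set q : ℝ := max 1 (-Real.log (δ / 9)) with hq
  have hq1 : 1 ≤ q := le_max_left _ _
  have hexp : Real.exp (-q) ≤ δ / 9 := by
    rw [← Real.le_log_iff_exp_le hδ']
    linarith [le_max_right 1 (-Real.log (δ / 9))]
  set B : ℝ := (|Cm| + 1) / (δ / 9) with hB
  have hB0 : 0 < B := by positivity
  have hCB : Cm / B ≤ δ / 9 := by
    rw [div_le_iff₀ hB0, hB, mul_div_cancel₀ _ hδ'.ne']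
    linarith [le_abs_self Cm]
  set D : ℝ := √B * |Cs| with hD
  have hD0 : 0 ≤ D := by positivity
  have ha0 : 0 ≤ κ * √Δ := by positivity
  have hb0 : 0 ≤ κ * √(d₁ * (q * Δ)) := by positivity
  refine ⟨κ * √(d₁ * (q * Δ)) + 4 * C₂ + 4 * C₃ + 4 * C₄ + 2 * D, by linarith, ?_⟩
  have small : ∀ {f : ℕ → ℝ}, Tendsto f atTop (𝓝 0) → ∀ᶠ n in atTop, D * f n ≤ 1 / 3 := by
    intro f hf
    have h := hf.const_mul D
    rw [mul_zero] at h
    exact h.eventually (eventually_le_nhds (by norm_num))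
  have hN' := (tendsto_natCast_atTop_atTop (R := ℝ)).comp hN
  have hT' := (tendsto_natCast_atTop_atTop (R := ℝ)).comp hT
  filter_upwards [small limG₁, small limQ₁, small limG₂, small limQ₂, hsieve,
    hN'.eventually_ge_atTop q, hT'.eventually_ge_atTop q,
    hgram.eventually (gt_mem_nhds (ENNReal.ofReal_pos.2 hδ')),
    hgram.eventually (gt_mem_nhds one_pos)] with n sG₁ sQ₁ sG₂ sQ₂ hS hNq hTq hgδ hg1
  -- the Gram event is nonempty, so the sieve dimension does not exceed the sample sizes
  have hne : ((S n).gramEvent c C).Nonempty := by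
    by_contra hemp
    rw [Set.not_nonempty_iff_eq_empty] at hemp
    rw [hemp, Set.compl_empty, measure_univ] at hg1
    exact lt_irrefl _ hg1
  obtain ⟨ω, hω⟩ := hne
  obtain ⟨hJN, hJT⟩ := (S n).J_le_of_mem_gramEvent hd₁ hd₂ (hJ n) hc hω
  have h := (S n).measure_rate_lt_frobNorm_le hd₁ hd₂ hCvar.le hCsub.le hκ hΔ hD hc hB0 hq1
    hC₂ hC₃ hC₄ (hJ n) hJN hJT hNq hTq (hnoise n) hS (hmom n) sG₁ sQ₁ sG₂ sQ₂ hgδ.le hexp hCB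
    (hMhat n)
  refine h.trans (le_of_eq ?_)
  rw [← ENNReal.ofReal_ofNat, ← ENNReal.ofReal_mul (by norm_num)]
  congr 1
  ring
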